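/- Consider spin-$\tfrac12$ particles (spin-orbit coupling) with time reversal $T$, $T^2=-1$, in a crystal with primitive lattice vectors $\mathbf t_1,\mathbf t_2$ in the $xy$ plane and $\mathbf t_3$ along $z$, and reciprocal vectors $\mathbf g_j$, $\mathbf t_i\cdot\mathbf g_j=2\pi\delta_{ij}$. Positions are given in the basis $\mathbf t_i$. A band representation is a finite direct sum of representations $\rho\uparrow G$ induced from double-valued unitary representations $\rho$ (with $T$) of site-symmetry groups $G_{\mathbf q}$ of the double space group $G$; it is elementary (an EBR) if it is nonzero and not equivalent, by a gauge transformation periodic in the Brillouin zone, to a direct sum of two nonzero band representations. Two band representations are irrep-equivalent if their little group characters agree at every $\mathbf k$. A Hilbert space with finitely many orbitals per cell is a band representation $B$. For a $G$- and $T$-symmetric Bloch Hamiltonian on it, a set of bands, and an orthonormal $C^1$ choice of Bloch states of these bands, with cell-periodic parts $u_m$, along the closed path $x\,\mathbf g_j$, $0\le x\le 1$, let $W_{\mathbf g_j}=\mathcal P e^{i\int A}$ with $A_{ml}=i\langle u_m|\partial u_l\rangle$. An isolated set of bands transforms as a band representation $E$ if it has a globally defined, Brillouin-zone-periodic, $C^1$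 orthonormal basis of Bloch states on which $G$ and $T$ act by the matrices of $E$. **(I) $P112$** ($G$ generated by translations and the two-fold rotation about $z$). 1. The sites in maximal Wyckoff positions are, up to lattice translations, $\mathbf q_a=(0,0,z)$, $\mathbf q_b=(0,\frac12,z)$, $\mathbf q_c=(\frac12,0,z)$, $\mathbf q_d=(\frac12,\frac12,z)$ with $z\in\mathbb R$. For each of them, $G_{\mathbf q_i}$ with $T$ has, up to equivalence, a unique irreducible double-valued representation $\rho_i$; it is two-dimensional, and $\rho_i\uparrow G$ is an EBR. 2. The four EBRs $\rho_i\uparrow G$ are pairwise irrep-equivalent, and their restrictions to every little group, including its antiunitary elements, are unitarily equivalent. However, for $i\ne j$ no continuous Brillouin-zone-periodic unitary gauge transformation that respects $G$ and $T$ relates $\rho_i\uparrow G$ and $\rho_j\uparrow G$. 3. For every finite-orbital Hilbert space and every symmetric Hamiltonian, if two bands do not touch any other band along the path of $\mathbf g_j$, $j\in\{1,2\}$, then their Wilson loop $W_{\mathbf g_j}$ (for any choice of Bloch states) is $\mathbb I$ or $-\mathbb I$. 4. If isolated bands in any such Hilbert space, possibly with further bands, transform as $\rho_i\uparrow G$,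 then $(W_{\mathbf g_1},W_{\mathbf g_2})$ is $(\mathbb I,\mathbb I)$, $(\mathbb I,-\mathbb I)$, $(-\mathbb I,\mathbb I)$, $(-\mathbb I,-\mathbb I)$ for $i=a,b,c,d$ respectively; so the pair of signs distinguishes the four EBRs. This includes the case in which the Hilbert space contains only the two orbitals in $\rho_i$, where the set of all bands transforms as $\rho_i\uparrow G$. **(II) $P11m$** ($Pm$; $G$ generated by translations and the reflection $z\mapsto -z$). The same holds with the two maximal Wyckoff positions $\mathbf q_a=(x,y,0)$, $\mathbf q_b=(x,y,\frac12)$, $x,y\in\mathbb R$, and the single Wilson loop $W_{\mathbf g_3}$: the sites in maximal positions are exactly these up to lattice translations; each has a unique irreducible double-valued representation with $T$, which is two-dimensional and induces an EBR; the two EBRs are irrep-equivalent (also for the little groups with antiunitary elements) but not related by a continuous Brillouin-zone-periodic gauge transformation; $W_{\mathbf g_3}=\pm\mathbb I$ for any two bands isolated from the other bands along the path; and $W_{\mathbf g_3}=\mathbb I$ or $-\mathbb I$ if the bands transform as the EBR induced from $\mathbf q_a$ or $\mathbf q_b$, respectively. -/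

import Mathlib

open Matrix Set
open scoped ComplexConjugate

/-! Coordinates.  Positions are written in the basis of the primitive lattice vectors `t₁, t₂, t₃`
and momenta as `k = (k₁ g₁ + k₂ g₂ + k₃ g₃) / 2π`, where `tᵢ · gⱼ = 2π δᵢⱼ`.  Thus the lattice is
`ℤ³`, the reciprocal lattice is `2π ℤ³`, and `k · r = ∑ i, kᵢ rᵢ`. -/

/-- The double space group generated by the primitive lattice translations and one operation `g`
whose spatial part is `{diag(s₁, s₂, s₃) | 0}` with signs `sᵢ` (a two-fold rotation or a mirror),
and whose square is the rotation `Ē` by `2π`, as for spin one-half.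
The element `⟨n, t⟩` is `{gⁿ | t}`; so `n = 0, 1, 2, 3` stand for `E`, `g`, `Ē`, `Ēg`. -/
@[ext] structure DoubleSpaceGroup (s : Fin 3 → ℤˣ) where
  pt : ZMod 4
  tr : Fin 3 → ℤ

namespace DoubleSpaceGroup

variable {s : Fin 3 → ℤˣ}

/-- The `i`-th diagonal entry of the rotational part of `{gⁿ | t}`. -/
def sign (s : Fin 3 → ℤˣ) (n : ZMod 4) (i : Fin 3) : ℤ := ((s i ^ n.val : ℤˣ) : ℤ)

lemma sign_zero (i : Fin 3) : sign s 0 i = 1 := by simp [sign]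

lemma sign_add (n m : ZMod 4) (i : Fin 3) : sign s (n + m) i = sign s n i * sign s m i := by
  unfold sign
  generalize s i = x
  revert n m x
  decide

lemma sign_neg (n : ZMod 4) (i : Fin 3) : sign s (-n) i = sign s n i := by
  unfold sign
  generalize s i = x
  revert n x
  decide

lemma sign_mul_self (n : ZMod 4) (i : Fin 3) : sign s n i * sign s n i = 1 := by
  unfold sign
  generalize s i = x
  revert n x
  decide

instance : Mul (DoubleSpaceGroup s) :=
  ⟨fun a b => ⟨a.pt + b.pt, fun i => a.tr i + sign s a.pt i * b.tr i⟩⟩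

instance : One (DoubleSpaceGroup s) := ⟨⟨0, 0⟩⟩

instance : Inv (DoubleSpaceGroup s) := ⟨fun a => ⟨-a.pt, fun i => -(sign s a.pt i * a.tr i)⟩⟩

lemma mul_pt (a b : DoubleSpaceGroup s) : (a * b).pt = a.pt + b.pt := rfl
lemma mul_tr (a b : DoubleSpaceGroup s) (i : Fin 3) :
    (a * b).tr i = a.tr i + sign s a.pt i * b.tr i := rfl
lemma one_pt : (1 : DoubleSpaceGroup s).pt = 0 := rfl
lemma one_tr (i : Fin 3) : (1 : DoubleSpaceGroup s).tr i = 0 := rfl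
lemma inv_pt (a : DoubleSpaceGroup s) : a⁻¹.pt = -a.pt := rfl
lemma inv_tr (a : DoubleSpaceGroup s) (i : Fin 3) : a⁻¹.tr i = -(sign s a.pt i * a.tr i) := rfl

instance : Group (DoubleSpaceGroup s) :=
  Group.ofLeftAxioms
    (by
      intro a b c
      ext i
      · simp [mul_pt, add_assoc]
      · simp only [mul_tr, mul_pt, sign_add]; ring)
    (by
      intro a
      ext i
      · simp [mul_pt, one_pt]
      · simp [mul_tr, one_pt, one_tr, sign_zero])
    (by
      intro a
      ext i
      · simp [mul_pt, one_pt, inv_pt]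
      · simp [mul_tr, inv_pt, inv_tr, one_tr, sign_neg])

/-- The lattice translation `{E | t}`. -/
def transl (t : Fin 3 → ℤ) : DoubleSpaceGroup s := ⟨0, t⟩

/-- The rotation `Ē` by `2π`. -/
def spinFlip : DoubleSpaceGroup s := ⟨2, 0⟩

/-- Action on positions, `{R | v} r = R r + v`. -/
def act (h : DoubleSpaceGroup s) (r : Fin 3 → ℝ) : Fin 3 → ℝ :=
  fun i => (sign s h.pt i : ℝ) * r i + (h.tr i : ℝ)

/-- Action on momenta, `{R | v} : k ↦ R k`. -/
def rot (h : DoubleSpaceGroup s) (k : Fin 3 → ℝ) : Fin 3 → ℝ :=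
  fun i => (sign s h.pt i : ℝ) * k i

lemma act_one (r : Fin 3 → ℝ) : act (1 : DoubleSpaceGroup s) r = r := by
  ext i; simp [act, one_pt, one_tr, sign_zero]

lemma act_mul (a b : DoubleSpaceGroup s) (r : Fin 3 → ℝ) : act (a * b) r = act a (act b r) := by
  ext i; simp only [act, mul_pt, mul_tr, sign_add]; push_cast; ring

/-- The site-symmetry group `G_q` (as a double group). -/
def siteGroup (s : Fin 3 → ℤˣ) (q : Fin 3 → ℝ) : Subgroup (DoubleSpaceGroup s) where
  carrier := {h | act h q = q}
  mul_mem' := by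
    intro a b ha hb
    simp only [mem_ofPred_eq] at ha hb ⊢
    rw [act_mul, hb, ha]
  one_mem' := act_one q
  inv_mem' := by
    intro a ha
    simp only [mem_ofPred_eq] at ha ⊢
    conv_lhs => rw [← ha]
    rw [← act_mul, inv_mul_cancel, act_one]

/-- A site is in a maximal Wyckoff position if its site-symmetry group is not properly contained
in the site-symmetry group of another site. -/
def IsMaximalSite (s : Fin 3 → ℤˣ) (q : Fin 3 → ℝ) : Prop :=
  ∀ q' : Fin 3 → ℝ, siteGroup s q ≤ siteGroup s q' → siteGroup s q' = siteGroup s q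

end DoubleSpaceGroup

open DoubleSpaceGroup

/-- Entrywise complex conjugate of a matrix. -/
noncomputable def cconj {m n : Type*} (M : Matrix m n ℂ) : Matrix m n ℂ := M.map (starRingEnd ℂ)

/-- A rectangular matrix is unitary if it is an isometry onto. -/
def IsUnitaryMatrix {m n : Type*} [Fintype m] [Fintype n] [DecidableEq m] [DecidableEq n]
    (M : Matrix m n ℂ) : Prop :=
  Mᴴ * M = 1 ∧ M * Mᴴ = 1

/-- The momenta `k` and `k'` differ by a reciprocal lattice vector. -/
def MomentumEquiv (k k' : Fin 3 → ℝ) : Prop :=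
  ∃ n : Fin 3 → ℤ, ∀ i, k' i = k i + 2 * Real.pi * (n i : ℝ)

/-- An `n`-dimensional double-valued unitary representation of the site-symmetry group `G_q`
together with time reversal: `Ē` acts as `-1`, and time reversal acts as the antiunitary operator
`v ↦ Θ v̄`, which commutes with `G_q` and squares to `-1`. -/
structure KramersRep (s : Fin 3 → ℤˣ) (q : Fin 3 → ℝ) (n : ℕ) where
  ρ : siteGroup s q →* Matrix (Fin n) (Fin n) ℂ
  Θ : Matrix (Fin n) (Fin n) ℂ
  unitary_ρ : ∀ h, IsUnitaryMatrix (ρ h)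
  unitary_Θ : IsUnitaryMatrix Θ
  double_valued : ∀ h : siteGroup s q, (h : DoubleSpaceGroup s) = spinFlip → ρ h = -1
  comm : ∀ h, Θ * cconj (ρ h) = ρ h * Θ
  sq : Θ * cconj Θ = -1

namespace KramersRep

variable {s : Fin 3 → ℤˣ} {q : Fin 3 → ℝ} {n m : ℕ}

/-- Irreducibility with respect to `G_q` and time reversal together. -/
def IsIrreducible (τ : KramersRep s q n) : Prop :=
  0 < n ∧ ∀ V : Submodule ℂ (Fin n → ℂ),
    (∀ h, ∀ v ∈ V, τ.ρ h *ᵥ v ∈ V) → (∀ v ∈ V, τ.Θ *ᵥ star v ∈ V) → V = ⊥ ∨ V = ⊤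

/-- Unitary equivalence, respecting time reversal. -/
def Equivalent (τ : KramersRep s q n) (τ' : KramersRep s q m) : Prop :=
  ∃ S : Matrix (Fin m) (Fin n) ℂ, IsUnitaryMatrix S ∧
    (∀ h, S * τ.ρ h = τ'.ρ h * S) ∧ S * τ.Θ = τ'.Θ * cconj S

open Classical in
/-- The extension `ρ̃` of `ρ` by zero to the whole space group. -/
noncomputable def extend (τ : KramersRep s q n) (h : DoubleSpaceGroup s) :
    Matrix (Fin n) (Fin n) ℂ :=
  if hh : h ∈ siteGroup s q then τ.ρ ⟨h, hh⟩ else 0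

end KramersRep

/-- Orbitals on all the sites of the orbit of one site `q`: a representation of `G_q` and time
reversal, and representatives `g_α` (one of them the identity) of the cosets in
`G = ⋃ α, g_α (G_q ⋉ ℤ³)`. -/
structure Shell (s : Fin 3 → ℤˣ) where
  site : Fin 3 → ℝ
  dim : ℕ
  rep : KramersRep s site dim
  mult : ℕ
  cosetRep : Fin mult → DoubleSpaceGroup s
  exists_one : ∃ α, cosetRep α = 1
  cosets : ∀ h : DoubleSpaceGroup s, ∃! α, ∃ t : Fin 3 → ℤ, ∃ g ∈ siteGroup s site,
    h = transl t * cosetRep α * g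

namespace Shell

variable {s : Fin 3 → ℤˣ} (a : Shell s)

/-- The sites `q_α = g_α q`. -/
def pos (α : Fin a.mult) : Fin 3 → ℝ := act (a.cosetRep α) a.site

/-- The lattice translation `t_βα(h) = h q_α - q_β`.  The integer part is taken entrywise so that
the translation is defined for all `α, β, h`; if `h q_α - q_β` is not a lattice vector, then
`g_β⁻¹ {E | -t_βα(h)} h g_α` is not in `G_q`, and the matrix element in `block` vanishes. -/
noncomputable def shift (h : DoubleSpaceGroup s) (β α : Fin a.mult) : Fin 3 → ℤ :=
  fun i => ⌊act h (a.pos α) i - a.pos β i⌋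

/-- The block `ρ_G^k(h)` of the induced band representation, mapping the Bloch sums
`∑ t, e^{i k·t} W_{iα}(r - t)` at `k` to those at `R k`:
`ρ_G^k(h)_{jβ,iα} = e^{-i (R k)·t_βα(h)} ρ̃_{ji}(g_β⁻¹ {E | -t_βα(h)} h g_α)`. -/
noncomputable def block (k : Fin 3 → ℝ) (h : DoubleSpaceGroup s) :
    Matrix (Fin a.mult × Fin a.dim) (Fin a.mult × Fin a.dim) ℂ :=
  fun x y =>
    Complex.exp (-Complex.I * ((∑ i, rot h k i * (a.shift h x.1 y.1 i : ℝ) : ℝ) : ℂ)) *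
      a.rep.extend ((a.cosetRep x.1)⁻¹ * transl (-a.shift h x.1 y.1) * h * a.cosetRep y.1) x.2 y.2

/-- The matrix of time reversal, which leaves every site fixed and maps `k` to `-k`. -/
def trBlock : Matrix (Fin a.mult × Fin a.dim) (Fin a.mult × Fin a.dim) ℂ :=
  fun x y => if x.1 = y.1 then a.rep.Θ x.2 y.2 else 0

end Shell

/-- A double-valued, time-reversal symmetric band representation: a finite direct sum of
representations induced from site-symmetry groups.  It is also the general form of a Hilbert
space with finitely many orbitals per primitive cell. -/
structure BandRep (s : Fin 3 → ℤˣ) where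
  num : ℕ
  shell : Fin num → Shell s

namespace BandRep

variable {s : Fin 3 → ℤˣ}

/-- Labels of the orbitals in one primitive cell. -/
abbrev Index (B : BandRep s) : Type :=
  Σ c : Fin B.num, Fin (B.shell c).mult × Fin (B.shell c).dim

/-- The position of an orbital. -/
def pos (B : BandRep s) (x : B.Index) : Fin 3 → ℝ := (B.shell x.1).pos x.2.1

noncomputable def block (B : BandRep s) (k : Fin 3 → ℝ) (h : DoubleSpaceGroup s) :
    Matrix B.Index B.Index ℂ :=
  Matrix.blockDiagonal' fun c => (B.shell c).block k h

def trBlock (B : BandRep s) : Matrix B.Index B.Index ℂ :=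
  Matrix.blockDiagonal' fun c => (B.shell c).trBlock

/-- The band representation `ρ ↑ G` induced from one site. -/
def induced (a : Shell s) : BandRep s := ⟨1, fun _ => a⟩

/-- Direct sum. -/
def sum (B C : BandRep s) : BandRep s := ⟨B.num + C.num, Fin.append B.shell C.shell⟩

/-- Irrep-equivalence: equal characters of all the little groups
`G_k = {h | R k ≡ k modulo reciprocal lattice vectors}`. -/
def IrrepEquivalent (B C : BandRep s) : Prop :=
  ∀ (k : Fin 3 → ℝ) (h : DoubleSpaceGroup s), MomentumEquiv k (rot h k) →
    (B.block k h).trace = (C.block k h).trace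

/-- The restrictions to every little group, including its antiunitary elements (products `hT` with
`R (-k) ≡ k`), are unitarily equivalent: both contain the same little group irreps. -/
def LittleGroupEquivalent (B C : BandRep s) : Prop :=
  ∀ k : Fin 3 → ℝ, ∃ S : Matrix C.Index B.Index ℂ, IsUnitaryMatrix S ∧
    (∀ h : DoubleSpaceGroup s, MomentumEquiv k (rot h k) →
      S * B.block k h = C.block k h * S) ∧
    (∀ h : DoubleSpaceGroup s, MomentumEquiv k (rot h (-k)) →
      S * (B.block (-k) h * B.trBlock) = (C.block (-k) h * C.trBlock) * cconj S)

/-- Two band representations are related by a continuous gauge transformation with the periodicity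
of the Brillouin zone. -/
def GaugeEquivalent (B C : BandRep s) : Prop :=
  ∃ U : (Fin 3 → ℝ) → Matrix C.Index B.Index ℂ,
    (∀ x y, Continuous fun k => U k x y) ∧ (∀ k, IsUnitaryMatrix (U k)) ∧
    (∀ k k', MomentumEquiv k k' → U k' = U k) ∧
    (∀ k h, C.block k h * U k = U (rot h k) * B.block k h) ∧
    (∀ k, C.trBlock * cconj (U k) = U (-k) * B.trBlock)

/-- An elementary band representation: nonzero and not equivalent to a direct sum of
(nonzero) band representations. -/
def IsElementary (B : BandRep s) : Prop :=
  Nonempty B.Index ∧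
    ∀ C D : BandRep s, Nonempty C.Index → Nonempty D.Index → ¬ GaugeEquivalent B (C.sum D)

end BandRep

/-- A Bloch Hamiltonian on the Hilbert space spanned by the orbitals of `B`, symmetric under the
space group and time reversal; its matrix is written in the basis of Bloch sums. -/
structure BlochHamiltonian {s : Fin 3 → ℤˣ} (B : BandRep s) where
  H : (Fin 3 → ℝ) → Matrix B.Index B.Index ℂ
  hermitian : ∀ k, (H k).IsHermitian
  periodic : ∀ k k', MomentumEquiv k k' → H k' = H k
  symm : ∀ k h, B.block k h * H k = H (rot h k) * B.block k h
  time_reversal : ∀ k, B.trBlock * cconj (H k) = H (-k) * B.trBlock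

namespace BlochHamiltonian

variable {s : Fin 3 → ℤˣ} {B : BandRep s} (𝓗 : BlochHamiltonian B)

/-- The energy of each band at `k`; the bands are labelled in decreasing order of energy. -/
noncomputable def energy (k : Fin 3 → ℝ) : Fin (Fintype.card B.Index) → ℝ :=
  (𝓗.hermitian k).eigenvalues₀

/-- At `k` the bands in `𝓑` do not touch any band outside `𝓑`. -/
def IsolatedAt (𝓑 : Finset (Fin (Fintype.card B.Index))) (k : Fin 3 → ℝ) : Prop :=
  ∀ b ∈ 𝓑, ∀ c ∉ 𝓑, 𝓗.energy k b ≠ 𝓗.energy k c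

/-- The space of Bloch states at `k` in the bands `𝓑`. -/
noncomputable def bandSpace (𝓑 : Finset (Fin (Fintype.card B.Index))) (k : Fin 3 → ℝ) :
    Submodule ℂ (B.Index → ℂ) :=
  Submodule.span ℂ {v | ∃ b ∈ 𝓑, 𝓗.H k *ᵥ v = (𝓗.energy k b : ℂ) • v}

/-- The isolated bands `𝓑` transform as the band representation `E`: there are Bloch states, periodic
in the Brillouin zone and continuously differentiable in `k`, that are an orthonormal basis of the
bands at every `k` and on which the space group and time reversal act by the matrices of `E`. -/
def TransformsAs (𝓑 : Finset (Fin (Fintype.card B.Index))) (E : BandRep s) : Prop :=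
  (∀ k, 𝓗.IsolatedAt 𝓑 k) ∧
  ∃ Φ : (Fin 3 → ℝ) → Matrix B.Index E.Index ℂ,
    (∀ x y, ContDiff ℝ 1 fun k => Φ k x y) ∧
    (∀ k k', MomentumEquiv k k' → Φ k' = Φ k) ∧
    (∀ k, (Φ k)ᴴ * Φ k = 1) ∧
    (∀ k, LinearMap.range (Φ k).mulVecLin = 𝓗.bandSpace 𝓑 k) ∧
    (∀ k h, B.block k h * Φ k = Φ (rot h k) * E.block k h) ∧
    (∀ k, B.trBlock * cconj (Φ k) = Φ (-k) * E.trBlock)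

end BlochHamiltonian

/-- The point `x gⱼ / 2π` of the line in the direction of the reciprocal lattice vector `gⱼ`. -/
def gLine (j : Fin 3) (x : ℝ) : Fin 3 → ℝ := Pi.single j x

/-- The cell-periodic parts `u_m` at `k` of the Bloch states with coefficients `ψ` in the basis of
Bloch sums: an orbital at `r` acquires the phase `e^{-i k·r}`. -/
noncomputable def cellPeriodic {s : Fin 3 → ℤˣ} (B : BandRep s) {N : ℕ} (k : Fin 3 → ℝ)
    (ψ : Matrix B.Index (Fin N) ℂ) : Matrix B.Index (Fin N) ℂ :=
  fun x m => Complex.exp (-Complex.I * ((∑ i, k i * B.pos x i : ℝ) : ℂ)) * ψ x m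

/-- `ψ` is a choice of orthonormal Bloch states spanning the bands `𝓑` along the closed path
`x gⱼ / 2π`, `0 ≤ x ≤ 2π`. -/
def IsBlochFrame {s : Fin 3 → ℤˣ} {B : BandRep s} (𝓗 : BlochHamiltonian B)
    (𝓑 : Finset (Fin (Fintype.card B.Index))) (j : Fin 3) {N : ℕ}
    (ψ : ℝ → Matrix B.Index (Fin N) ℂ) : Prop :=
  (∀ x m, ContDiffOn ℝ 1 (fun t => ψ t x m) (Icc 0 (2 * Real.pi))) ∧
  (∀ t ∈ Icc 0 (2 * Real.pi), (ψ t)ᴴ * ψ t = 1 ∧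
    LinearMap.range (ψ t).mulVecLin = 𝓗.bandSpace 𝓑 (gLine j t)) ∧
  ψ (2 * Real.pi) = ψ 0

/-- The Berry connection `A_{ml} = i ⟨u_m | ∂ u_l⟩` along the path. -/
noncomputable def berryConnection {s : Fin 3 → ℤˣ} (B : BandRep s) (j : Fin 3) {N : ℕ}
    (ψ : ℝ → Matrix B.Index (Fin N) ℂ) (t : ℝ) : Matrix (Fin N) (Fin N) ℂ :=
  fun m l => Complex.I * ∑ x, conj (cellPeriodic B (gLine j t) (ψ t) x m) *
    derivWithin (fun y => cellPeriodic B (gLine j y) (ψ y) x l) (Icc 0 (2 * Real.pi)) t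

/-- `W` is the path-ordered exponential `𝓟 exp (i ∫ A)` over `[0, 2π]`: the value at `2π` of the
solution of `Y' = i A Y`, `Y(0) = 1`. -/
def IsPathOrderedExp {N : ℕ} (A : ℝ → Matrix (Fin N) (Fin N) ℂ)
    (W : Matrix (Fin N) (Fin N) ℂ) : Prop :=
  ∃ Y : ℝ → Matrix (Fin N) (Fin N) ℂ, Y 0 = 1 ∧
    (∀ t ∈ Icc 0 (2 * Real.pi), ∀ m l,
      HasDerivWithinAt (fun y => Y y m l) (Complex.I * (A t * Y t) m l)
        (Icc 0 (2 * Real.pi)) t) ∧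
    Y (2 * Real.pi) = W

/-- The `gⱼ`-directed Wilson loop of the Bloch states `ψ` exists, is unique, and equals `W`. -/
def WilsonLoopEq {s : Fin 3 → ℤˣ} (B : BandRep s) (j : Fin 3) {N : ℕ}
    (ψ : ℝ → Matrix B.Index (Fin N) ℂ) (W : Matrix (Fin N) (Fin N) ℂ) : Prop :=
  ∀ W', IsPathOrderedExp (berryConnection B j ψ) W' ↔ W' = W

/-- `P112`: two-fold rotation about the `z` axis; `t₁, t₂` are in the `xy` plane and `t₃` along
`z`. -/
def P112 : Fin 3 → ℤˣ := ![-1, -1, 1]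

/-- `P11m`: reflection `z ↦ -z`; `t₁, t₂` are in the `xy` plane and `t₃` along `z`. -/
def P11m : Fin 3 → ℤˣ := ![1, 1, -1]

inductive WyckoffP112
  | a | b | c | d

/-- The sites of the maximal Wyckoff positions of `P112`. -/
noncomputable def WyckoffP112.site : WyckoffP112 → ℝ → Fin 3 → ℝ
  | .a, z => ![0, 0, z]
  | .b, z => ![0, 1 / 2, z]
  | .c, z => ![1 / 2, 0, z]
  | .d, z => ![1 / 2, 1 / 2, z]

/-- The eigenvalues of the Wilson loops in the directions `g₁` and `g₂`. -/
def WyckoffP112.wilson : WyckoffP112 → Fin 2 → ℂ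
  | .a => ![1, 1]
  | .b => ![1, -1]
  | .c => ![-1, 1]
  | .d => ![-1, -1]

inductive WyckoffP11m
  | a | b

/-- The sites of the maximal Wyckoff positions of `P11m`. -/
noncomputable def WyckoffP11m.site : WyckoffP11m → ℝ → ℝ → Fin 3 → ℝ
  | .a, x, y => ![x, y, 0]
  | .b, x, y => ![x, y, 1 / 2]

/-- The eigenvalue of the Wilson loop in the direction `g₃`. -/
def WyckoffP11m.wilson : WyckoffP11m → ℂ
  | .a => 1
  | .b => -1

/-- The site `q` has a unique double-valued irreducible representation with time reversal, and it is
two-dimensional. -/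
def HasUniqueKramersIrrep (s : Fin 3 → ℤˣ) (q : Fin 3 → ℝ) : Prop :=
  ∃ τ : KramersRep s q 2, τ.IsIrreducible ∧
    ∀ (n : ℕ) (τ' : KramersRep s q n), τ'.IsIrreducible → τ'.Equivalent τ

/-- `a` consists of orbitals in a double-valued irreducible representation (with time reversal) of
the site-symmetry group of `q`. -/
def Shell.IsIrrepAt {s : Fin 3 → ℤˣ} (a : Shell s) (q : Fin 3 → ℝ) : Prop :=
  a.site = q ∧ a.rep.IsIrreducible

/-!
The two space groups are treated together: `s` gives the signs of the diagonal point operation,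
whose lift to the double group squares to `Ē`, and `j` is a direction with `s j = -1`, so that the
operation reverses the line `k = t gⱼ / 2π`.

**Sites and representations.** A site is maximal exactly if the point operation fixes it up to a
lattice translation `m` (`IsSymmetricSite`, `isMaximalSite_iff`). Its site-symmetry group is then
cyclic of order four, generated by an element represented by a matrix of square `-1`, whose
eigenvalues `±i` are exchanged by time reversal. Hence there is a single irreducible representation,
the Kramers doublet (`equivalent_kramersDoublet`), and the induced band representation has one
doublet per cell and a phase as its only dependence on the site (`Shell.IsIrrepAt.normal_form`). It
is elementary because Kramers degeneracy makes the number of orbitals of every band representation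
even. At momenta fixed by the point operation the phases of two sites differ at most by a sign,
which interchanging the two states of the doublet compensates
(`exists_little_group_intertwiner`); this gives the equivalence on the little groups.

**Quantization of the Wilson loop.** For cell-periodic parts, time reversal and the point operation
act by matrices independent of the momentum (`BandRep.cellPhase_mul_block`). Along the line, their
product is a constant antiunitary operator that preserves the space of the bands at each point,
while time reversal maps the path to its reverse. If `v` is a parallel frame, the matrix elements of
a constant antiunitary symmetry between parallel sections are constant
(`IsParallelFrame.conjTranspose_mul_mul_cconj_eq`). Comparing the two ends of the path gives
`Wᴴ J = J W̄` with the antisymmetric matrix `J` of time reversal, which forces the `2 × 2` matrix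
`W` to be a scalar, and `Wᴴ a W̄ = a` with the matrix `a ≠ 0` of the product, which forces the scalar to
have square `1` (`IsSymmetricLoop.wilson_eq_one_or_neg_one`). Existence of the Wilson loop is the
solvability of linear differential equations (`exists_linear_ode_solution`), and uniqueness follows
from the constancy of the scalar products of parallel sections.

**The sign.** In a global frame that transforms as the representation induced from `q`, the
determinant of a parallel frame is `exp (2 i t qⱼ)` up to a constant factor, by the antiunitary
symmetry of each point and continuity. Time reversal relates its value at the midpoint `t = π` to
the end points, so that `W = exp (2 π i qⱼ)` (`IsSymmetricLoop.wilson_eq_exp`). The same determinant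
argument, applied to a gauge transformation, which belongs to `SU(2)` at `t = 0` and `t = π`, shows
that distinct sites give distinct band representations
(`Shell.IsIrrepAt.exp_eq_of_gaugeEquivalent`).
-/

/-! ### Complex conjugation of matrices -/

section Conj

variable {l m n : Type*}

@[simp] lemma cconj_apply (M : Matrix m n ℂ) (i : m) (j : n) : cconj M i j = conj (M i j) := rfl

@[simp] lemma cconj_cconj (M : Matrix m n ℂ) : cconj (cconj M) = M := by ext; simp

lemma cconj_mul [Fintype m] (M : Matrix l m ℂ) (N : Matrix m n ℂ) :
    cconj (M * N) = cconj M * cconj N := by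
  ext; simp [Matrix.mul_apply, map_sum]

@[simp] lemma cconj_one [DecidableEq n] : cconj (1 : Matrix n n ℂ) = 1 := by
  ext i j; by_cases h : i = j <;> simp [Matrix.one_apply, h]

@[simp] lemma cconj_neg (M : Matrix m n ℂ) : cconj (-M) = -cconj M := by ext; simp

lemma cconj_smul (c : ℂ) (M : Matrix m n ℂ) : cconj (c • M) = conj c • cconj M := by ext; simp

lemma cconj_conjTranspose (M : Matrix m n ℂ) : cconj Mᴴ = Mᵀ := by ext; simp

lemma cconj_transpose (M : Matrix m n ℂ) : cconj Mᵀ = Mᴴ := by ext; simp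

lemma conjTranspose_cconj (M : Matrix m n ℂ) : (cconj M)ᴴ = Mᵀ := by ext; simp

lemma det_cconj [Fintype n] [DecidableEq n] (M : Matrix n n ℂ) :
    (cconj M).det = conj M.det := by
  exact (RingHom.map_det (starRingEnd ℂ) M).symm

end Conj

section Unitary

variable {l m n : Type*} [Fintype l] [Fintype m] [Fintype n] [DecidableEq l] [DecidableEq m]
  [DecidableEq n]

lemma IsUnitaryMatrix.mul {M : Matrix l m ℂ} {N : Matrix m n ℂ} (hM : IsUnitaryMatrix M)
    (hN : IsUnitaryMatrix N) : IsUnitaryMatrix (M * N) := by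
  constructor
  · rw [conjTranspose_mul, Matrix.mul_assoc, ← Matrix.mul_assoc Mᴴ, hM.1, Matrix.one_mul, hN.1]
  · rw [conjTranspose_mul, Matrix.mul_assoc, ← Matrix.mul_assoc N, hN.2, Matrix.one_mul, hM.2]

lemma IsUnitaryMatrix.conjTranspose {M : Matrix m n ℂ} (hM : IsUnitaryMatrix M) :
    IsUnitaryMatrix Mᴴ := by
  simpa [IsUnitaryMatrix, and_comm] using! hM

lemma isUnitaryMatrix_of_mul {M : Matrix n n ℂ} (h : Mᴴ * M = 1) : IsUnitaryMatrix M :=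
  ⟨h, mul_eq_one_comm.1 h⟩

lemma isUnitaryMatrix_one : IsUnitaryMatrix (1 : Matrix n n ℂ) := by simp [IsUnitaryMatrix]

lemma IsUnitaryMatrix.smul {M : Matrix m n ℂ} (hM : IsUnitaryMatrix M) {c : ℂ}
    (hc : conj c * c = 1) : IsUnitaryMatrix (c • M) := by
  have hc' : c * conj c = 1 := by rw [mul_comm, hc]
  simp [IsUnitaryMatrix, smul_smul, hM.1, hM.2, hc, hc']

lemma IsUnitaryMatrix.card_eq {M : Matrix m n ℂ} (hM : IsUnitaryMatrix M) :
    Fintype.card m = Fintype.card n := by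
  have h := Matrix.trace_mul_comm M Mᴴ
  rw [hM.1, hM.2] at h
  simpa using! h

lemma IsUnitaryMatrix.conj_det_mul_det {M : Matrix n n ℂ} (hM : IsUnitaryMatrix M) :
    conj M.det * M.det = 1 := by
  have h := congrArg Matrix.det hM.1
  rw [Matrix.det_mul, Matrix.det_conjTranspose] at h
  simpa using! h

end Unitary

/-! ### Calculus of matrix-valued functions -/

section Deriv

variable {l m n : Type*} {s : Set ℝ} {t : ℝ}

/-- The matrix-valued function `F` has the derivative `F'` at `t` within `s`, entry by entry. -/
def HasMatDeriv (F : ℝ → Matrix l m ℂ) (F' : Matrix l m ℂ) (s : Set ℝ) (t : ℝ) :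
    Prop :=
  ∀ i j, HasDerivWithinAt (fun x => F x i j) (F' i j) s t

lemma HasMatDeriv.mul [Fintype m] {F : ℝ → Matrix l m ℂ} {G : ℝ → Matrix m n ℂ} {F' : Matrix l m ℂ}
    {G' : Matrix m n ℂ} (hF : HasMatDeriv F F' s t) (hG : HasMatDeriv G G' s t) :
    HasMatDeriv (fun x => F x * G x) (F' * G t + F t * G') s t := by
  intro i j
  have h := HasDerivWithinAt.fun_sum (u := Finset.univ) fun k _ => (hF i k).mul (hG k j)
  simpa [Matrix.mul_apply, Finset.sum_add_distrib] using! h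

lemma HasMatDeriv.cconj {F : ℝ → Matrix l m ℂ} {F' : Matrix l m ℂ} (hF : HasMatDeriv F F' s t) :
    HasMatDeriv (fun x => cconj (F x)) (cconj F') s t := fun i j => (hF i j).star

lemma HasMatDeriv.conjTranspose {F : ℝ → Matrix l m ℂ} {F' : Matrix l m ℂ}
    (hF : HasMatDeriv F F' s t) : HasMatDeriv (fun x => (F x)ᴴ) F'ᴴ s t :=
  fun i j => (hF j i).star

lemma hasMatDeriv_const (C : Matrix l m ℂ) : HasMatDeriv (fun _ => C) 0 s t :=
  fun _ _ => hasDerivWithinAt_const ..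

lemma HasMatDeriv.eq_of_zero {F : ℝ → Matrix l m ℂ} {T : ℝ}
    (hF : ∀ t ∈ Icc 0 T, HasMatDeriv F 0 (Icc 0 T) t) : ∀ t ∈ Icc 0 T, F t = F 0 := by
  intro t ht
  ext i j
  refine constant_of_derivWithin_zero (f := fun x => F x i j)
    (fun x hx => (hF x hx i j).differentiableWithinAt) (fun x hx => ?_) t ht
  exact (hF x (Ico_subset_Icc_self hx) i j).derivWithin
    (uniqueDiffOn_Icc (hx.1.trans_lt hx.2) x (Ico_subset_Icc_self hx))

end Deriv

/-! ### Linear differential equations -/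

section ODE

variable {R : Type*} [NormedRing R] [NormedAlgebra ℝ R] [CompleteSpace R]

lemma exists_linear_ode_solution_short {b : ℝ → R} (hb : Continuous b) {C δ : ℝ} (hC : 0 ≤ C)
    (hbC : ∀ t, ‖b t‖ ≤ C) (hδ : 0 ≤ δ) (hCδ : C * δ * 2 ≤ 1) (a : ℝ) (x₀ : R) :
    ∃ y : ℝ → R, y a = x₀ ∧
      ∀ t ∈ Icc a (a + δ), HasDerivWithinAt y (b t * y t) (Icc a (a + δ)) t := by
  have ha : a ∈ Icc a (a + δ) := ⟨le_rfl, by linarith⟩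
  have h : IsPicardLindelof (fun t x => b t * x) (⟨a, ha⟩ : Icc a (a + δ)) x₀ ‖x₀‖₊ 0
      (⟨C, hC⟩ * (2 * ‖x₀‖₊)) ⟨C, hC⟩ := by
    refine ⟨fun t _ => ?_, fun x _ => by fun_prop, fun t _ x hx => ?_, ?_⟩
    · refine LipschitzWith.lipschitzOnWith (LipschitzWith.of_dist_le_mul fun x y => ?_)
      rw [dist_eq_norm, dist_eq_norm, ← mul_sub]
      exact (norm_mul_le _ _).trans (mul_le_mul_of_nonneg_right (hbC t) (norm_nonneg _))
    · have h1 : ‖x‖ ≤ 2 * ‖x₀‖ := by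
        have h2 := mem_closedBall_iff_norm.1 hx
        have h3 := norm_sub_norm_le x x₀
        simp only [coe_nnnorm] at h2
        linarith
      exact (norm_mul_le _ _).trans (mul_le_mul (hbC t) h1 (norm_nonneg _) hC)
    · have : 0 ≤ ‖x₀‖ := norm_nonneg _
      have h1 : C * (2 * ‖x₀‖) * δ ≤ ‖x₀‖ := by nlinarith
      simpa [hδ] using! h1
  exact h.exists_eq_forall_mem_Icc_hasDerivWithinAt₀

/-- A linear differential equation `y' = b y` with continuous coefficient has a solution on every
bounded interval: the coefficient bounds the length on which Picard iteration converges, uniformly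
in the initial value, so that finitely many short solutions can be glued. -/
lemma exists_linear_ode_solution {b : ℝ → R} {T : ℝ} (hT : 0 ≤ T)
    (hb : ContinuousOn b (Icc 0 T)) (x₀ : R) :
    ∃ y : ℝ → R, y 0 = x₀ ∧ ∀ t ∈ Icc 0 T, HasDerivWithinAt y (b t * y t) (Icc 0 T) t := by
  let c : ℝ → R := fun t => b (projIcc 0 T hT t)
  have hc : Continuous c := hb.comp_continuous (by fun_prop) fun t => (projIcc 0 T hT t).2
  obtain ⟨C, hC⟩ := isCompact_Icc.exists_bound_of_continuousOn hb
  have hC0 : 0 ≤ C := (norm_nonneg _).trans (hC 0 ⟨le_rfl, hT⟩)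
  have hcC : ∀ t, ‖c t‖ ≤ C := fun t => hC _ (projIcc 0 T hT t).2
  let δ : ℝ := 1 / (2 * (C + 1))
  have hδ : 0 < δ := by positivity
  have hCδ : C * δ * 2 ≤ 1 := by
    simp only [δ]
    rw [mul_one_div, div_mul_eq_mul_div, div_le_one (by positivity)]
    linarith
  have key : ∀ n : ℕ, ∃ y : ℝ → R, y 0 = x₀ ∧
      ∀ t ∈ Icc 0 (n * δ), HasDerivWithinAt y (c t * y t) (Icc 0 (n * δ)) t := by
    intro n
    induction n with
    | zero =>
      refine ⟨fun _ => x₀, rfl, fun t ht => ?_⟩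
      simp only [Nat.cast_zero, zero_mul, Icc_self]
      exact HasFDerivWithinAt.of_subsingleton subsingleton_singleton
    | succ n ih =>
      obtain ⟨y, hy0, hy⟩ := ih
      set a : ℝ := n * δ with ha
      have ha0 : 0 ≤ a := by positivity
      have hsucc : ((n + 1 : ℕ) : ℝ) * δ = a + δ := by push_cast; ring
      obtain ⟨z, hza, hz⟩ := exists_linear_ode_solution_short hc hC0 hcC hδ.le hCδ a (y a)
      let w : ℝ → R := fun t => if t ≤ a then y t else z t
      have hwy : ∀ t ∈ Icc 0 a, w t = y t := fun t ht => if_pos ht.2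
      have hwz : ∀ t ∈ Icc a (a + δ), w t = z t := by
        intro t ht
        by_cases h : t ≤ a
        · obtain rfl := le_antisymm h ht.1
          simp [w, hza]
        · exact if_neg h
      refine ⟨w, by rw [hwy 0 ⟨le_rfl, ha0⟩, hy0], fun t ht => ?_⟩
      rw [hsucc] at ht ⊢
      rw [← Icc_union_Icc_eq_Icc ha0 (by linarith : a ≤ a + δ)] at ht ⊢
      have h1 : HasDerivWithinAt w (c t * w t) (Icc 0 a) t := by
        by_cases h : t ∈ Icc 0 a
        · rw [hwy t h]
          exact (hy t h).congr hwy (hwy t h)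
        · exact HasFDerivWithinAt.of_notMem_closure (by rwa [closure_Icc])
      have h2 : HasDerivWithinAt w (c t * w t) (Icc a (a + δ)) t := by
        by_cases h : t ∈ Icc a (a + δ)
        · rw [hwz t h]
          exact (hz t h).congr hwz (hwz t h)
        · exact HasFDerivWithinAt.of_notMem_closure (by rwa [closure_Icc])
      exact h1.union h2
  obtain ⟨n, hn⟩ := exists_nat_ge (T / δ)
  have hTn : T ≤ n * δ := by rwa [div_le_iff₀ hδ] at hn
  obtain ⟨y, hy0, hy⟩ := key n
  refine ⟨y, hy0, fun t ht => ?_⟩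
  have h := (hy t ⟨ht.1, ht.2.trans hTn⟩).mono (Icc_subset_Icc_right hTn)
  simpa [c, projIcc_of_mem hT ht] using! h

end ODE

section MatrixODE

open scoped Matrix.Norms.Operator

lemma exists_matrix_ode_solution {N : ℕ} {b : ℝ → Matrix (Fin N) (Fin N) ℂ} {T : ℝ} (hT : 0 ≤ T)
    (hb : ∀ i j, ContinuousOn (fun t => b t i j) (Icc 0 T)) :
    ∃ Y : ℝ → Matrix (Fin N) (Fin N) ℂ, Y 0 = 1 ∧
      ∀ t ∈ Icc 0 T, HasMatDeriv Y (b t * Y t) (Icc 0 T) t := by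
  have hb' : ContinuousOn b (Icc 0 T) :=
    continuousOn_pi.2 fun i => continuousOn_pi.2 fun j => hb i j
  obtain ⟨Y, h0, hY⟩ := exists_linear_ode_solution hT hb' 1
  refine ⟨Y, h0, fun t ht i j => ?_⟩
  let e : Matrix (Fin N) (Fin N) ℂ →L[ℝ] ℂ :=
    LinearMap.toContinuousLinearMap (Matrix.entryLinearMap ℝ ℂ i j)
  exact e.hasFDerivAt.comp_hasDerivWithinAt t (hY t ht)

end MatrixODE

/-! ### Parallel transport in a family of subspaces -/

section Parallel

variable {I : Type*} [Fintype I] {N : ℕ}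

/-- The columns of `v t` are sections, parallel for the Berry connection, of the family of spaces
spanned by the columns of the isometries `u t`, for `0 ≤ t ≤ T`: their derivatives `v' t` are
orthogonal to these spaces. -/
structure IsParallelFrame (u v v' : ℝ → Matrix I (Fin N) ℂ) (T : ℝ) : Prop where
  deriv : ∀ t ∈ Icc 0 T, HasMatDeriv v (v' t) (Icc 0 T) t
  horizontal : ∀ t ∈ Icc 0 T, (u t)ᴴ * v' t = 0
  mem_range : ∀ t ∈ Icc 0 T, ∃ Y : Matrix (Fin N) (Fin N) ℂ, v t = u t * Y

variable {u v v' u₁ v₁ v₁' u₂ v₂ v₂' : ℝ → Matrix I (Fin N) ℂ} {T : ℝ}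

lemma IsParallelFrame.reverse (h : IsParallelFrame u v v' T) :
    IsParallelFrame (fun t => u (T - t)) (fun t => v (T - t)) (fun t => -v' (T - t)) T := by
  have hmem : ∀ t ∈ Icc 0 T, T - t ∈ Icc 0 T := fun t ht => ⟨by linarith [ht.2], by linarith [ht.1]⟩
  refine ⟨fun t ht i j => ?_, fun t ht => ?_, fun t ht => h.mem_range _ (hmem t ht)⟩
  · have h1 : HasDerivWithinAt (fun x : ℝ => T - x) (-1) (Icc 0 T) t :=
      (hasDerivWithinAt_id t _).const_sub T
    have h2 := (h.deriv _ (hmem t ht) i j).scomp t h1 hmem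
    simpa [Function.comp_def] using! h2
  · rw [Matrix.mul_neg, h.horizontal _ (hmem t ht), neg_zero]

lemma IsParallelFrame.conjTranspose_mul_eq (h₁ : IsParallelFrame u v₁ v₁' T)
    (h₂ : IsParallelFrame u v₂ v₂' T) :
    ∀ t ∈ Icc 0 T, (v₁ t)ᴴ * v₂ t = (v₁ 0)ᴴ * v₂ 0 := by
  refine HasMatDeriv.eq_of_zero (F := fun t => (v₁ t)ᴴ * v₂ t) fun t ht => ?_
  have h := (h₁.deriv t ht).conjTranspose.mul (h₂.deriv t ht)
  obtain ⟨Y₁, hY₁⟩ := h₁.mem_range t ht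
  obtain ⟨Y₂, hY₂⟩ := h₂.mem_range t ht
  have e₁ : (v₁' t)ᴴ * u t = 0 := by simpa using! congrArg Matrix.conjTranspose (h₁.horizontal t ht)
  rwa [hY₁, hY₂, conjTranspose_mul, Matrix.mul_assoc, h₂.horizontal t ht, ← Matrix.mul_assoc, e₁,
    Matrix.mul_zero, Matrix.zero_mul, add_zero] at h

/-- A constant antiunitary operator `x ↦ C x̄` that maps one family of spaces to another one maps
parallel sections to parallel sections; hence the matrix elements of the operator between parallel
sections are constant. -/
lemma IsParallelFrame.conjTranspose_mul_mul_cconj_eq [DecidableEq I]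
    (h₁ : IsParallelFrame u₁ v₁ v₁' T) (h₂ : IsParallelFrame u₂ v₂ v₂' T)
    (hu₁ : ∀ t ∈ Icc 0 T, (u₁ t)ᴴ * u₁ t = 1) (hu₂ : ∀ t ∈ Icc 0 T, (u₂ t)ᴴ * u₂ t = 1)
    {C : Matrix I I ℂ} (hC : IsUnitaryMatrix C)
    (hCu : ∀ t ∈ Icc 0 T, ∃ b : Matrix (Fin N) (Fin N) ℂ, C * cconj (u₂ t) = u₁ t * b) :
    ∀ t ∈ Icc 0 T, (v₁ t)ᴴ * C * cconj (v₂ t) = (v₁ 0)ᴴ * C * cconj (v₂ 0) := by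
  refine HasMatDeriv.eq_of_zero (F := fun t => (v₁ t)ᴴ * C * cconj (v₂ t)) fun t ht => ?_
  have h := ((h₁.deriv t ht).conjTranspose.mul (hasMatDeriv_const C)).mul (h₂.deriv t ht).cconj
  obtain ⟨Y₁, hY₁⟩ := h₁.mem_range t ht
  obtain ⟨Y₂, hY₂⟩ := h₂.mem_range t ht
  obtain ⟨b, hb⟩ := hCu t ht
  -- `b` is unitary, so that the operator maps the second space onto the first one
  have hbb : bᴴ * b = 1 := by
    have h3 : (C * cconj (u₂ t))ᴴ * (C * cconj (u₂ t)) = 1 := by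
      rw [conjTranspose_mul, Matrix.mul_assoc, ← Matrix.mul_assoc Cᴴ, hC.1, Matrix.one_mul,
        conjTranspose_cconj, ← cconj_conjTranspose, ← cconj_mul, hu₂ t ht, cconj_one]
    rwa [hb, conjTranspose_mul, Matrix.mul_assoc, ← Matrix.mul_assoc (u₁ t)ᴴ, hu₁ t ht,
      Matrix.one_mul] at h3
  have hu : (u₁ t)ᴴ * C = b * (cconj (u₂ t))ᴴ := by
    have h4 : u₁ t = C * cconj (u₂ t) * bᴴ := by
      rw [hb, Matrix.mul_assoc, mul_eq_one_comm.1 hbb, Matrix.mul_one]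
    rw [h4, conjTranspose_mul, conjTranspose_mul, conjTranspose_conjTranspose, Matrix.mul_assoc,
      Matrix.mul_assoc, hC.1, Matrix.mul_one]
  have e₁ : (v₁' t)ᴴ * u₁ t = 0 := by
    simpa using! congrArg Matrix.conjTranspose (h₁.horizontal t ht)
  have e₂ : (cconj (u₂ t))ᴴ * cconj (v₂' t) = 0 := by
    rw [conjTranspose_cconj, ← cconj_conjTranspose, ← cconj_mul, h₂.horizontal t ht]
    ext; simp
  have z₁ : (v₁' t)ᴴ * C * cconj (v₂ t) = 0 := by
    rw [hY₂, cconj_mul, Matrix.mul_assoc, ← Matrix.mul_assoc C, hb, Matrix.mul_assoc,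
      ← Matrix.mul_assoc, e₁, Matrix.zero_mul]
  have z₂ : (v₁ t)ᴴ * C * cconj (v₂' t) = 0 := by
    rw [hY₁, conjTranspose_mul, Matrix.mul_assoc, Matrix.mul_assoc, ← Matrix.mul_assoc (u₁ t)ᴴ, hu,
      Matrix.mul_assoc, e₂, Matrix.mul_zero, Matrix.mul_zero]
  simpa [z₁, z₂] using! h

end Parallel

/-! ### Wilson loops -/

section Wilson

variable {I : Type*} [Fintype I] {N : ℕ} {u u' : ℝ → Matrix I (Fin N) ℂ}
  {W W' : Matrix (Fin N) (Fin N) ℂ}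

lemma two_pi_nonneg : 0 ≤ 2 * Real.pi := by positivity

/-- The solution of the differential equation of the Wilson loop turns the frame `u` into a
parallel one. -/
lemma IsPathOrderedExp.exists_parallel
    (hu : ∀ t ∈ Icc 0 (2 * Real.pi), HasMatDeriv u (u' t) (Icc 0 (2 * Real.pi)) t)
    (hiso : ∀ t ∈ Icc 0 (2 * Real.pi), (u t)ᴴ * u t = 1)
    (hW : IsPathOrderedExp (fun t => Complex.I • ((u t)ᴴ * u' t)) W) :
    ∃ v v', IsParallelFrame u v v' (2 * Real.pi) ∧ v 0 = u 0 ∧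
      v (2 * Real.pi) = u (2 * Real.pi) * W := by
  obtain ⟨Y, hY0, hY, hYW⟩ := hW
  refine ⟨fun t => u t * Y t, fun t => u' t * Y t + u t * -((u t)ᴴ * u' t * Y t),
    ⟨fun t ht => ?_, fun t ht => ?_, fun t _ => ⟨Y t, rfl⟩⟩, by simp [hY0], by simp [hYW]⟩
  · refine (hu t ht).mul fun i j => ?_
    have h := hY t ht i j
    have e : Complex.I * (Complex.I • ((u t)ᴴ * u' t) * Y t) i j
        = (-((u t)ᴴ * u' t * Y t)) i j := by
      rw [Matrix.smul_mul, Matrix.smul_apply, smul_eq_mul, ← mul_assoc, Complex.I_mul_I,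
        Matrix.neg_apply, neg_one_mul]
    rwa [e] at h
  · rw [Matrix.mul_add, ← Matrix.mul_assoc, ← Matrix.mul_assoc, hiso t ht, Matrix.one_mul,
      add_neg_cancel]

lemma exists_isPathOrderedExp
    (hu : ∀ t ∈ Icc 0 (2 * Real.pi), HasMatDeriv u (u' t) (Icc 0 (2 * Real.pi)) t)
    (hu' : ∀ i j, ContinuousOn (fun t => u' t i j) (Icc 0 (2 * Real.pi))) :
    ∃ W, IsPathOrderedExp (fun t => Complex.I • ((u t)ᴴ * u' t)) W := by
  obtain ⟨Y, hY0, hY⟩ := exists_matrix_ode_solution (b := fun t => -((u t)ᴴ * u' t)) two_pi_nonneg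
    (fun i j => by
      simp only [Matrix.neg_apply, Matrix.mul_apply, conjTranspose_apply]
      refine (continuousOn_finsetSum _ fun k _ => ContinuousOn.mul ?_ (hu' k j)).neg
      exact continuous_star.comp_continuousOn fun t ht => (hu t ht k i).continuousWithinAt)
  refine ⟨_, Y, hY0, fun t ht i j => ?_, rfl⟩
  have h := hY t ht i j
  have e : Complex.I * (Complex.I • ((u t)ᴴ * u' t) * Y t) i j
      = (-((u t)ᴴ * u' t) * Y t) i j := by
    rw [Matrix.smul_mul, Matrix.smul_apply, smul_eq_mul, ← mul_assoc, Complex.I_mul_I,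
      Matrix.neg_mul, Matrix.neg_apply, neg_one_mul]
  rwa [e]

lemma IsPathOrderedExp.conjTranspose_mul_eq_one
    (hu : ∀ t ∈ Icc 0 (2 * Real.pi), HasMatDeriv u (u' t) (Icc 0 (2 * Real.pi)) t)
    (hiso : ∀ t ∈ Icc 0 (2 * Real.pi), (u t)ᴴ * u t = 1)
    (hW : IsPathOrderedExp (fun t => Complex.I • ((u t)ᴴ * u' t)) W)
    (hW' : IsPathOrderedExp (fun t => Complex.I • ((u t)ᴴ * u' t)) W') : Wᴴ * W' = 1 := by
  obtain ⟨v, v', hv, h0, h1⟩ := hW.exists_parallel hu hiso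
  obtain ⟨w, w', hw, k0, k1⟩ := hW'.exists_parallel hu hiso
  have h := hv.conjTranspose_mul_eq hw (2 * Real.pi) ⟨two_pi_nonneg, le_rfl⟩
  rwa [h0, h1, k0, k1, hiso 0 ⟨le_rfl, two_pi_nonneg⟩, conjTranspose_mul, Matrix.mul_assoc,
    ← Matrix.mul_assoc _ _ W', hiso _ ⟨two_pi_nonneg, le_rfl⟩, Matrix.one_mul] at h

lemma IsPathOrderedExp.unique
    (hu : ∀ t ∈ Icc 0 (2 * Real.pi), HasMatDeriv u (u' t) (Icc 0 (2 * Real.pi)) t)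
    (hiso : ∀ t ∈ Icc 0 (2 * Real.pi), (u t)ᴴ * u t = 1)
    (hW : IsPathOrderedExp (fun t => Complex.I • ((u t)ᴴ * u' t)) W)
    (hW' : IsPathOrderedExp (fun t => Complex.I • ((u t)ᴴ * u' t)) W') : W' = W := by
  have h1 := mul_eq_one_comm.1 (hW.conjTranspose_mul_eq_one hu hiso hW)
  rw [← Matrix.one_mul W', ← h1, Matrix.mul_assoc, hW.conjTranspose_mul_eq_one hu hiso hW',
    Matrix.mul_one]

end Wilson

section TwoBands

/-- Kramers degeneracy in the algebraic form used here: since the antisymmetric `2 × 2` matrices are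
multiples of a single one, a matrix that satisfies this relation with one of them is scalar. -/
lemma eq_smul_one_of_antisymm {W J : Matrix (Fin 2) (Fin 2) ℂ} (hJ : Jᵀ = -J) (hJ0 : J ≠ 0)
    (h : Wᴴ * J = J * cconj W) : W = W 0 0 • 1 := by
  have j00 : J 0 0 = 0 := by
    have := congrFun (congrFun hJ 0) 0
    simp at this
    linear_combination this / 2
  have j11 : J 1 1 = 0 := by
    have := congrFun (congrFun hJ 1) 1
    simp at this
    linear_combination this / 2
  have j10 : J 1 0 = -J 0 1 := by simpa using! congrFun (congrFun hJ 0) 1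
  have j01 : J 0 1 ≠ 0 := by
    intro h0
    apply hJ0
    ext i j
    fin_cases i <;> fin_cases j <;> simp [j00, j11, j10, h0]
  have e00 := congrFun (congrFun h 0) 0
  have e01 := congrFun (congrFun h 0) 1
  have e11 := congrFun (congrFun h 1) 1
  simp [Matrix.mul_apply, Fin.sum_univ_two, j00, j11, j10] at e00 e01 e11
  have w10 : W 1 0 = 0 := by
    have : conj (W 1 0) * J 0 1 = 0 := by linear_combination -e00 / 2
    simpa [j01] using! this
  have w01 : W 0 1 = 0 := by
    have : conj (W 0 1) * J 0 1 = 0 := by linear_combination e11 / 2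
    simpa [j01] using! this
  have w11 : W 1 1 = W 0 0 := by
    have : conj (W 0 0 - W 1 1) * J 0 1 = 0 := by rw [map_sub]; linear_combination e01
    simp only [mul_eq_zero, j01, or_false, map_eq_zero] at this
    linear_combination -this
  ext i j
  fin_cases i <;> fin_cases j <;> simp [w10, w01, w11]

/-- An antisymmetric bilinear form in two dimensions transforms by the determinant. -/
lemma conjTranspose_mul_mul_cconj_of_antisymm {J : Matrix (Fin 2) (Fin 2) ℂ} (hJ : Jᵀ = -J)
    (Z : Matrix (Fin 2) (Fin 2) ℂ) : Zᴴ * J * cconj Z = conj Z.det • J := by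
  have j00 : J 0 0 = 0 := by
    have := congrFun (congrFun hJ 0) 0
    simp at this
    linear_combination this / 2
  have j11 : J 1 1 = 0 := by
    have := congrFun (congrFun hJ 1) 1
    simp at this
    linear_combination this / 2
  have j10 : J 1 0 = -J 0 1 := by simpa using! congrFun (congrFun hJ 0) 1
  ext i j
  fin_cases i <;> fin_cases j <;>
    simp [Matrix.mul_apply, Fin.sum_univ_two, j00, j11, j10, Matrix.det_fin_two] <;> ring

variable {I : Type*} [Fintype I] [DecidableEq I]

/-- A family of two-dimensional spaces along a closed path `0 ≤ t ≤ 2π`, spanned by the columns of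
isometries `u t`, where `V` closes the path. It is invariant under the constant antiunitary
operator `x ↦ A x̄` at each `t`, and under `x ↦ V Θ x̄` as `t ↦ 2π - t`; here `x ↦ Θ x̄` is time
reversal, and `A` is its product with a spatial operation that reverses the path. -/
structure IsSymmetricLoop (u : ℝ → Matrix I (Fin 2) ℂ) (V A Θ : Matrix I I ℂ) : Prop where
  iso : ∀ t ∈ Icc 0 (2 * Real.pi), (u t)ᴴ * u t = 1
  unitary_V : IsUnitaryMatrix V
  unitary_A : IsUnitaryMatrix A
  unitary_Θ : IsUnitaryMatrix Θ
  antisymm : Θᵀ = -Θ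
  commute_A : Vᴴ * A * cconj V = A
  commute_Θ : V * Θ * cconj V = Θ
  invariant_A : ∀ t ∈ Icc 0 (2 * Real.pi),
    ∃ a : Matrix (Fin 2) (Fin 2) ℂ, A * cconj (u t) = u t * a
  invariant_Θ : ∀ t ∈ Icc 0 (2 * Real.pi),
    ∃ b : Matrix (Fin 2) (Fin 2) ℂ, V * Θ * cconj (u t) = u (2 * Real.pi - t) * b
  closed : u (2 * Real.pi) = V * u 0

variable {u v v' : ℝ → Matrix I (Fin 2) ℂ} {V A Θ : Matrix I I ℂ}

lemma IsSymmetricLoop.form_A_const (h : IsSymmetricLoop u V A Θ)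
    (hv : IsParallelFrame u v v' (2 * Real.pi)) :
    ∀ t ∈ Icc 0 (2 * Real.pi), (v t)ᴴ * A * cconj (v t) = (v 0)ᴴ * A * cconj (v 0) :=
  hv.conjTranspose_mul_mul_cconj_eq hv h.iso h.iso h.unitary_A h.invariant_A

lemma IsSymmetricLoop.form_Θ_const (h : IsSymmetricLoop u V A Θ)
    (hv : IsParallelFrame u v v' (2 * Real.pi)) :
    ∀ t ∈ Icc 0 (2 * Real.pi), (v (2 * Real.pi - t))ᴴ * (V * Θ) * cconj (v t) =
      (v (2 * Real.pi))ᴴ * (V * Θ) * cconj (v 0) := by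
  have k := hv.reverse.conjTranspose_mul_mul_cconj_eq hv
    (fun t ht => h.iso _ ⟨by linarith [ht.2], by linarith [ht.1]⟩) h.iso
    (h.unitary_V.mul h.unitary_Θ) h.invariant_Θ
  simpa using! k

/-- Time reversal makes the Wilson loop `W` of two bands scalar, and the operation that combines
it with the spatial symmetry makes the scalar real. -/
theorem IsSymmetricLoop.wilson_eq_one_or_neg_one (h : IsSymmetricLoop u V A Θ)
    (hv : IsParallelFrame u v v' (2 * Real.pi)) (h0 : v 0 = u 0) {W : Matrix (Fin 2) (Fin 2) ℂ}
    (h1 : v (2 * Real.pi) = u (2 * Real.pi) * W) : W = 1 ∨ W = -1 := by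
  have m0 : (0 : ℝ) ∈ Icc 0 (2 * Real.pi) := ⟨le_rfl, two_pi_nonneg⟩
  have m1 : 2 * Real.pi ∈ Icc 0 (2 * Real.pi) := ⟨two_pi_nonneg, le_rfl⟩
  rw [h.closed] at h1
  set J : Matrix (Fin 2) (Fin 2) ℂ := (u 0)ᴴ * Θ * cconj (u 0) with hJdef
  have hJ : Jᵀ = -J := by
    rw [hJdef, transpose_mul, transpose_mul, h.antisymm, ← conjTranspose_cconj, cconj_cconj,
      ← cconj_conjTranspose, conjTranspose_conjTranspose]
    simp [Matrix.mul_assoc]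
  -- time reversal preserves the space at `t = 0`, where its matrix is `J`
  have hJu : Θ * cconj (u 0) = u 0 * J := by
    obtain ⟨b, hb⟩ := h.invariant_Θ 0 m0
    rw [sub_zero, h.closed, Matrix.mul_assoc, Matrix.mul_assoc] at hb
    have hb' : Θ * cconj (u 0) = u 0 * b := by
      have := congrArg (Vᴴ * ·) hb
      simpa only [← Matrix.mul_assoc, h.unitary_V.1, Matrix.one_mul] using! this
    rw [hJdef, Matrix.mul_assoc, hb', ← Matrix.mul_assoc (u 0)ᴴ, h.iso 0 m0, Matrix.one_mul]
  have inj : ∀ {C : Matrix I I ℂ} {X : Matrix (Fin 2) (Fin 2) ℂ}, IsUnitaryMatrix C →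
      C * cconj (u 0) = u 0 * X → X ≠ 0 := by
    rintro C X hC hX rfl
    have h2 : cconj (u 0) = 0 := by
      rw [← Matrix.one_mul (cconj (u 0)), ← hC.1, Matrix.mul_assoc, hX]; simp
    have h3 : u 0 = 0 := by rw [← cconj_cconj (u 0), h2]; ext; simp
    have h4 := h.iso 0 m0
    simp [h3] at h4
  have hJ0 : J ≠ 0 := inj h.unitary_Θ hJu
  have hWJ : Wᴴ * J = J * cconj W := by
    have k := h.form_Θ_const hv (2 * Real.pi) m1
    rw [sub_self, h0, h1, cconj_mul, cconj_mul, conjTranspose_mul, conjTranspose_mul] at k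
    calc Wᴴ * J = Wᴴ * ((u 0)ᴴ * Vᴴ) * (V * Θ) * cconj (u 0) := by
          have e : (u 0)ᴴ * Θ = (u 0)ᴴ * (Vᴴ * (V * Θ)) := by
            rw [← Matrix.mul_assoc Vᴴ, h.unitary_V.1, Matrix.one_mul]
          rw [hJdef, e]; simp only [Matrix.mul_assoc]
      _ = (u 0)ᴴ * (V * Θ) * (cconj V * cconj (u 0) * cconj W) := k.symm
      _ = (u 0)ᴴ * (V * Θ * cconj V) * cconj (u 0) * cconj W := by simp only [Matrix.mul_assoc]
      _ = J * cconj W := by rw [h.commute_Θ]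
  have hW := eq_smul_one_of_antisymm hJ hJ0 hWJ
  generalize W 0 0 = c at hW
  subst hW
  obtain ⟨a, ha⟩ := h.invariant_A 0 m0
  have ha0 : a ≠ 0 := inj h.unitary_A ha
  have hWa : conj c ^ 2 • a = a := by
    have k := h.form_A_const hv (2 * Real.pi) m1
    have e : (u 0)ᴴ * A * cconj (u 0) = a := by
      rw [Matrix.mul_assoc, ha, ← Matrix.mul_assoc, h.iso 0 m0, Matrix.one_mul]
    rw [h0, h1, e, Matrix.mul_smul, Matrix.mul_one, cconj_smul, cconj_mul, conjTranspose_smul,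
      conjTranspose_mul] at k
    calc conj c ^ 2 • a = conj c ^ 2 • ((u 0)ᴴ * (Vᴴ * A * cconj V) * cconj (u 0)) := by
          rw [h.commute_A, e]
      _ = a := by
          rw [← k]
          simp only [Matrix.mul_assoc, Matrix.smul_mul, Matrix.mul_smul, smul_smul, pow_two]
          rfl
  have hc : conj c ^ 2 = 1 := by
    have : (conj c ^ 2 - 1) • a = 0 := by rw [sub_smul, hWa, one_smul, sub_self]
    simpa [ha0, sub_eq_zero] using! this
  have hc' : c ^ 2 = 1 := by simpa using! congrArg conj hc
  rcases mul_self_eq_one_iff.1 (pow_two c ▸ hc') with rfl | rfl <;> simp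

/-- If the spaces have a global frame `φ` on which the symmetries act by constant matrices up to the
phase `exp (2 i t q)` of the spatial operation, then this phase determines the Wilson loop: in the
frame `φ`, the determinant of a parallel frame is `exp (2 i t q)` up to a constant factor, and
time reversal identifies its value at the midpoint `t = π` with the Wilson loop. -/
theorem IsSymmetricLoop.wilson_eq_exp (h : IsSymmetricLoop u V A Θ)
    (hv : IsParallelFrame u v v' (2 * Real.pi)) (h0 : v 0 = u 0) {c : ℂ}
    (h1 : v (2 * Real.pi) = u (2 * Real.pi) * (c • (1 : Matrix (Fin 2) (Fin 2) ℂ)))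
    {φ : ℝ → Matrix I (Fin 2) ℂ}
    (hφc : ∀ i j, ContinuousOn (fun t => φ t i j) (Icc 0 (2 * Real.pi)))
    (hφ : ∀ t ∈ Icc 0 (2 * Real.pi), (φ t)ᴴ * φ t = 1)
    (hrange : ∀ t ∈ Icc 0 (2 * Real.pi), ∃ X : Matrix (Fin 2) (Fin 2) ℂ, u t = φ t * X)
    (hclosed : φ (2 * Real.pi) = V * φ 0) {K L : Matrix (Fin 2) (Fin 2) ℂ} {q : ℝ}
    (hA : ∀ t ∈ Icc 0 (2 * Real.pi),
      A * cconj (φ t) = φ t * (Complex.exp (2 * Complex.I * t * q) • K))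
    (hΘ : ∀ t ∈ Icc 0 (2 * Real.pi), V * Θ * cconj (φ t) = φ (2 * Real.pi - t) * L)
    (hK : K.det ≠ 0) (hL : Lᵀ = -L) (hL0 : L ≠ 0) :
    c = Complex.exp (2 * Complex.I * Real.pi * q) := by
  have hpi := Real.pi_pos
  have m0 : (0 : ℝ) ∈ Icc 0 (2 * Real.pi) := ⟨le_rfl, two_pi_nonneg⟩
  have m1 : 2 * Real.pi ∈ Icc 0 (2 * Real.pi) := ⟨two_pi_nonneg, le_rfl⟩
  have mp : Real.pi ∈ Icc 0 (2 * Real.pi) := ⟨by linarith, by linarith⟩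
  set Z : ℝ → Matrix (Fin 2) (Fin 2) ℂ := fun t => (φ t)ᴴ * v t with hZdef
  have hvZ : ∀ t ∈ Icc 0 (2 * Real.pi), v t = φ t * Z t := by
    intro t ht
    obtain ⟨Y, hY⟩ := hv.mem_range t ht
    obtain ⟨X, hX⟩ := hrange t ht
    simp only [hZdef]
    rw [hY, hX, Matrix.mul_assoc, ← Matrix.mul_assoc (φ t)ᴴ, hφ t ht, Matrix.one_mul]
  have hZZ : ∀ t ∈ Icc 0 (2 * Real.pi), IsUnitaryMatrix (Z t) := by
    intro t ht
    have k := hv.conjTranspose_mul_eq hv t ht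
    rw [h0, h.iso 0 m0, hvZ t ht, conjTranspose_mul, Matrix.mul_assoc, ← Matrix.mul_assoc (φ t)ᴴ,
      hφ t ht, Matrix.one_mul] at k
    exact isUnitaryMatrix_of_mul k
  have hd0 : (Z 0).det ≠ 0 := right_ne_zero_of_mul (by rw [(hZZ 0 m0).conj_det_mul_det]; simp)
  have hZc : ∀ i j, ContinuousOn (fun t => Z t i j) (Icc 0 (2 * Real.pi)) := by
    intro i j
    simp only [hZdef, Matrix.mul_apply, conjTranspose_apply]
    refine continuousOn_finsetSum _ fun k _ => ContinuousOn.mul ?_ ?_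
    · exact continuous_star.comp_continuousOn (hφc k i)
    · exact fun t ht => (hv.deriv t ht k j).continuousWithinAt
  have hZ1 : Z (2 * Real.pi) = c • Z 0 := by
    simp only [hZdef]
    rw [h1, h.closed, hclosed, h0, conjTranspose_mul, Matrix.mul_smul, Matrix.mul_one,
      Matrix.mul_smul, Matrix.mul_assoc, ← Matrix.mul_assoc Vᴴ, h.unitary_V.1, Matrix.one_mul]
  have hdet : ∀ t ∈ Icc 0 (2 * Real.pi),
      (Z t).det ^ 2 = (Complex.exp (2 * Complex.I * t * q) * (Z 0).det) ^ 2 := by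
    intro t ht
    have form : ∀ t ∈ Icc 0 (2 * Real.pi), ((v t)ᴴ * A * cconj (v t)).det =
        conj (Z t).det ^ 2 * Complex.exp (2 * Complex.I * t * q) ^ 2 * K.det := by
      intro t ht
      rw [hvZ t ht, conjTranspose_mul, cconj_mul, Matrix.mul_assoc, ← Matrix.mul_assoc A, hA t ht,
        Matrix.mul_assoc, ← Matrix.mul_assoc (φ t)ᴴ, ← Matrix.mul_assoc (φ t)ᴴ, hφ t ht,
        Matrix.one_mul, Matrix.det_mul, Matrix.det_mul, Matrix.det_conjTranspose, det_cconj,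
        Matrix.det_smul, Fintype.card_fin]
      simp only [starRingEnd_apply]
      ring
    have k := form t ht
    rw [h.form_A_const hv t ht, form 0 m0] at k
    have k2 := mul_right_cancel₀ hK k
    have k3 := congrArg conj k2
    have e : conj (Complex.exp (2 * Complex.I * t * q)) *
        Complex.exp (2 * Complex.I * t * q) = 1 := by
      rw [← Complex.exp_conj, ← Complex.exp_add]
      simp [Complex.conj_ofNat]
    simp only [map_mul, map_pow, Complex.conj_conj, Complex.ofReal_zero, mul_zero, zero_mul,
      Complex.exp_zero, one_pow, mul_one] at k3
    generalize Complex.exp (2 * Complex.I * t * q) = x at e k3 ⊢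
    rw [mul_pow, k3]
    linear_combination -(Z t).det ^ 2 * (1 + conj x * x) * e
  -- a continuous function with this square is determined by its value at `t = 0`
  have hdetpi : (Z Real.pi).det = Complex.exp (2 * Complex.I * Real.pi * q) * (Z 0).det := by
    have hc1 : ContinuousOn (fun t => (Z t).det) (Icc 0 (2 * Real.pi)) := by
      simp only [Matrix.det_fin_two]
      exact ((hZc 0 0).mul (hZc 1 1)).sub ((hZc 0 1).mul (hZc 1 0))
    have hc2 : ContinuousOn (fun t : ℝ => Complex.exp (2 * Complex.I * t * q) * (Z 0).det)
        (Icc 0 (2 * Real.pi)) := by fun_prop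
    rcases isPreconnected_Icc.eq_or_eq_neg_of_sq_eq hc1 hc2 hdet
      (fun {t} _ => mul_ne_zero (Complex.exp_ne_zero _) hd0) with k | k
    · exact k mp
    · have := k m0
      simp [self_eq_neg] at this
      exact absurd this hd0
  have k := h.form_Θ_const hv Real.pi mp
  have e1 : 2 * Real.pi - Real.pi = Real.pi := by ring
  have e2 : (v (2 * Real.pi - Real.pi))ᴴ * (V * Θ) * cconj (v Real.pi) =
      conj (Z Real.pi).det • L := by
    have := hΘ Real.pi mp
    rw [e1] at this ⊢
    rw [hvZ _ mp, conjTranspose_mul, cconj_mul, Matrix.mul_assoc, ← Matrix.mul_assoc (V * Θ), this,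
      Matrix.mul_assoc, ← Matrix.mul_assoc (φ _)ᴴ, ← Matrix.mul_assoc (φ _)ᴴ, hφ _ mp,
      Matrix.one_mul, ← Matrix.mul_assoc, conjTranspose_mul_mul_cconj_of_antisymm hL]
  have e3 : (v (2 * Real.pi))ᴴ * (V * Θ) * cconj (v 0) = (conj c * conj (Z 0).det) • L := by
    have := hΘ 0 m0
    rw [sub_zero] at this
    rw [hvZ _ m1, hvZ _ m0, conjTranspose_mul, cconj_mul, Matrix.mul_assoc,
      ← Matrix.mul_assoc (V * Θ), this, Matrix.mul_assoc, ← Matrix.mul_assoc (φ _)ᴴ,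
      ← Matrix.mul_assoc (φ _)ᴴ, hφ _ m1, Matrix.one_mul, hZ1, conjTranspose_smul,
      Matrix.smul_mul, ← Matrix.mul_assoc, conjTranspose_mul_mul_cconj_of_antisymm hL, smul_smul]
    rfl
  rw [e2, e3, ← sub_eq_zero, ← sub_smul, smul_eq_zero, or_iff_left hL0, sub_eq_zero] at k
  have k' := congrArg conj k
  rw [map_mul, Complex.conj_conj, Complex.conj_conj, Complex.conj_conj, hdetpi] at k'
  exact (mul_right_cancel₀ hd0 k').symm

end TwoBands

/-! ### Site-symmetry groups -/

section Site

variable {s : Fin 3 → ℤˣ} {q : Fin 3 → ℝ} {m : Fin 3 → ℤ}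

lemma mem_siteGroup {h : DoubleSpaceGroup s} :
    h ∈ siteGroup s q ↔ ∀ i, (sign s h.pt i : ℝ) * q i + (h.tr i : ℝ) = q i := by
  change act h q = q ↔ _
  rw [funext_iff]; rfl

/-- Up to the lattice translation `m`, the site `q` is fixed by the point operation
`diag(s₁, s₂, s₃)`. -/
def IsSymmetricSite (s : Fin 3 → ℤˣ) (q : Fin 3 → ℝ) (m : Fin 3 → ℤ) : Prop :=
  ∀ i, q i - ((s i : ℤ) : ℝ) * q i = (m i : ℝ)

lemma sign_pt_one (i : Fin 3) : sign s 1 i = (s i : ℤ) := by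
  have : (1 : ZMod 4).val = 1 := rfl
  simp [sign, this]

lemma sign_pt_two (i : Fin 3) : sign s 2 i = 1 := by
  rw [show (2 : ZMod 4) = 1 + 1 from rfl, sign_add, sign_mul_self]

lemma sign_pt_three (i : Fin 3) : sign s 3 i = (s i : ℤ) := by
  rw [show (3 : ZMod 4) = 2 + 1 from rfl, sign_add, sign_pt_two, sign_pt_one, one_mul]

lemma zmod_four_cases (n : ZMod 4) : n = 0 ∨ n = 1 ∨ n = 2 ∨ n = 3 := by
  revert n; decide

lemma eq_of_mem_siteGroup {h h' : DoubleSpaceGroup s} (hh : h ∈ siteGroup s q)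
    (hh' : h' ∈ siteGroup s q) (hpt : h.pt = h'.pt) : h = h' := by
  rw [mem_siteGroup] at hh hh'
  refine DoubleSpaceGroup.ext hpt (funext fun i => ?_)
  have h1 := hh i
  have h2 := hh' i
  rw [hpt] at h1
  have : (h.tr i : ℝ) = h'.tr i := by linarith
  exact_mod_cast this

lemma spinFlip_mem_siteGroup : (spinFlip : DoubleSpaceGroup s) ∈ siteGroup s q := by
  rw [mem_siteGroup]
  intro i
  change (sign s 2 i : ℝ) * q i + ((0 : ℤ) : ℝ) = q i
  simp [sign_pt_two]

lemma IsSymmetricSite.mem (hq : IsSymmetricSite s q m) :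
    (⟨1, m⟩ : DoubleSpaceGroup s) ∈ siteGroup s q := by
  rw [mem_siteGroup]
  intro i
  have := hq i
  simp only [sign_pt_one]
  linarith

/-- The generator of the site-symmetry group of a symmetric site. -/
def IsSymmetricSite.gen (hq : IsSymmetricSite s q m) : siteGroup s q := ⟨⟨1, m⟩, hq.mem⟩

lemma IsSymmetricSite.gen_pow_pt (hq : IsSymmetricSite s q m) (n : ℕ) :
    ((hq.gen ^ n : siteGroup s q) : DoubleSpaceGroup s).pt = (n : ZMod 4) := by
  induction n with
  | zero => rfl
  | succ n ih => rw [pow_succ, Subgroup.coe_mul, mul_pt, ih, Nat.cast_succ]; rfl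

lemma IsSymmetricSite.eq_gen_pow (hq : IsSymmetricSite s q m) (h : siteGroup s q) :
    h = hq.gen ^ (h : DoubleSpaceGroup s).pt.val :=
  Subtype.ext <| eq_of_mem_siteGroup h.2 (hq.gen ^ _).2 (by rw [hq.gen_pow_pt]; simp)

lemma isMaximalSite_iff : IsMaximalSite s q ↔ ∃ m, IsSymmetricSite s q m := by
  constructor
  · intro hmax
    by_contra hno
    have hpt : ∀ h ∈ siteGroup s q, h.pt = 0 ∨ h.pt = 2 := by
      intro h hh
      have odd : (∀ i, sign s h.pt i = (s i : ℤ)) → False := by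
        intro hs
        refine hno ⟨h.tr, fun i => ?_⟩
        have := mem_siteGroup.1 hh i
        rw [hs i] at this
        linarith
      rcases zmod_four_cases h.pt with h0 | h0 | h0 | h0
      · exact .inl h0
      · exact (odd fun i => by rw [h0, sign_pt_one]).elim
      · exact .inr h0
      · exact (odd fun i => by rw [h0, sign_pt_three]).elim
    have hle : siteGroup s q ≤ siteGroup s 0 := by
      intro h hh
      rcases hpt h hh with h0 | h0
      · rw [eq_of_mem_siteGroup hh (one_mem _) h0]; exact one_mem _
      · rw [eq_of_mem_siteGroup hh spinFlip_mem_siteGroup h0]; exact spinFlip_mem_siteGroup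
    have h1 : (⟨1, 0⟩ : DoubleSpaceGroup s) ∈ siteGroup s 0 := by simp [mem_siteGroup]
    rw [hmax 0 hle] at h1
    rcases hpt _ h1 with h2 | h2
    · exact absurd h2 (by change (1 : ZMod 4) ≠ 0; decide)
    · exact absurd h2 (by change (1 : ZMod 4) ≠ 2; decide)
  · rintro ⟨m, hq⟩ q' hle
    refine le_antisymm (fun h hh => ?_) hle
    have h1 := (hq.gen ^ h.pt.val).2
    rwa [eq_of_mem_siteGroup hh (hle h1) (by rw [hq.gen_pow_pt]; simp)]

end Site

/-! ### Irreducible representations of the site-symmetry groups -/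

section Std

/-- The matrix of the generator of a site-symmetry group in the Kramers doublet. -/
noncomputable def kramersM : Matrix (Fin 2) (Fin 2) ℂ := !![Complex.I, 0; 0, -Complex.I]

/-- The matrix of time reversal in the Kramers doublet. -/
def kramersΘ : Matrix (Fin 2) (Fin 2) ℂ := !![0, -1; 1, 0]

lemma kramersM_mulVec (v : Fin 2 → ℂ) : kramersM *ᵥ v = ![Complex.I * v 0, -Complex.I * v 1] := by
  ext i; fin_cases i <;> simp [kramersM, Matrix.mulVec, dotProduct, Fin.sum_univ_two]

lemma kramersΘ_mulVec (v : Fin 2 → ℂ) : kramersΘ *ᵥ v = ![-v 1, v 0] := by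
  ext i; fin_cases i <;> simp [kramersΘ, Matrix.mulVec, dotProduct, Fin.sum_univ_two]

lemma kramersM_sq : kramersM ^ 2 = -1 := by
  ext i j; fin_cases i <;> fin_cases j <;> simp [kramersM, pow_two]

lemma kramersM_pow_four : kramersM ^ 4 = 1 := by
  rw [show 4 = 2 * 2 from rfl, pow_mul, kramersM_sq]; simp

lemma kramersM_pow_add (a b : ZMod 4) :
    kramersM ^ (a + b).val = kramersM ^ a.val * kramersM ^ b.val := by
  rw [← pow_add, pow_eq_pow_mod (a.val + b.val) kramersM_pow_four, ZMod.val_add]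

lemma isUnitaryMatrix_kramersM : IsUnitaryMatrix kramersM := by
  refine isUnitaryMatrix_of_mul ?_
  ext i j; fin_cases i <;> fin_cases j <;> simp [kramersM, Matrix.mul_apply, Fin.sum_univ_two]

lemma isUnitaryMatrix_kramersΘ : IsUnitaryMatrix kramersΘ := by
  refine isUnitaryMatrix_of_mul ?_
  ext i j; fin_cases i <;> fin_cases j <;> simp [kramersΘ, Matrix.mul_apply, Fin.sum_univ_two]

lemma cconj_kramersΘ : cconj kramersΘ = kramersΘ := by
  ext i j; fin_cases i <;> fin_cases j <;> simp [kramersΘ]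

lemma kramersΘ_mul_self : kramersΘ * kramersΘ = -1 := by
  ext i j; fin_cases i <;> fin_cases j <;> simp [kramersΘ]

lemma kramersΘ_transpose : kramersΘᵀ = -kramersΘ := by
  ext i j; fin_cases i <;> fin_cases j <;> simp [kramersΘ]

lemma kramersΘ_ne_zero : kramersΘ ≠ 0 := fun h => by
  simpa [kramersΘ] using! congrFun (congrFun h 1) 0

lemma cconj_kramersM : cconj kramersM = -kramersM := by
  ext i j; fin_cases i <;> fin_cases j <;> simp [kramersM]

lemma kramersΘ_mul_kramersM : kramersΘ * kramersM = -(kramersM * kramersΘ) := by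
  ext i j; fin_cases i <;> fin_cases j <;> simp [kramersΘ, kramersM]

lemma det_kramersM : kramersM.det = 1 := by simp [kramersM]

lemma det_kramersΘ : kramersΘ.det = 1 := by simp [kramersΘ]

lemma trace_kramersM : kramersM.trace = 0 := by simp [kramersM, Matrix.trace_fin_two]

lemma isUnitaryMatrix_kramersM_pow (n : ℕ) : IsUnitaryMatrix (kramersM ^ n) := by
  induction n with
  | zero => simpa using! isUnitaryMatrix_one
  | succ n ih => rw [pow_succ]; exact ih.mul isUnitaryMatrix_kramersM

lemma kramersΘ_mul_cconj_kramersM_pow (n : ℕ) :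
    kramersΘ * cconj (kramersM ^ n) = kramersM ^ n * kramersΘ := by
  induction n with
  | zero => simp
  | succ n ih =>
    rw [pow_succ, cconj_mul, ← Matrix.mul_assoc, ih, Matrix.mul_assoc, cconj_kramersM,
      Matrix.mul_neg, kramersΘ_mul_kramersM, neg_neg, Matrix.mul_assoc]

/-- The Kramers doublet: the point operation has the eigenvalues `±i`, which time reversal
interchanges. -/
noncomputable def kramersDoublet (s : Fin 3 → ℤˣ) (q : Fin 3 → ℝ) : KramersRep s q 2 where
  ρ :=
    { toFun := fun h => kramersM ^ (h : DoubleSpaceGroup s).pt.val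
      map_one' := by simp [one_pt]
      map_mul' := fun a b => by rw [Subgroup.coe_mul, mul_pt, kramersM_pow_add] }
  Θ := kramersΘ
  unitary_ρ _ := isUnitaryMatrix_kramersM_pow _
  unitary_Θ := isUnitaryMatrix_kramersΘ
  double_valued h hh := by
    simp only [MonoidHom.coe_mk, OneHom.coe_mk, hh]
    exact kramersM_sq
  comm _ := kramersΘ_mul_cconj_kramersM_pow _
  sq := by rw [cconj_kramersΘ, kramersΘ_mul_self]

variable {s : Fin 3 → ℤˣ} {q : Fin 3 → ℝ} {m : Fin 3 → ℤ}

lemma kramersDoublet_ρ (h : siteGroup s q) :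
    (kramersDoublet s q).ρ h = kramersM ^ (h : DoubleSpaceGroup s).pt.val := rfl

lemma kramersDoublet_isIrreducible (hq : IsSymmetricSite s q m) :
    (kramersDoublet s q).IsIrreducible := by
  refine ⟨by norm_num, fun V hρ hΘ => ?_⟩
  by_cases hV : V = ⊥
  · exact .inl hV
  refine .inr ?_
  have hM : ∀ v ∈ V, ![Complex.I * v 0, -Complex.I * v 1] ∈ V := by
    intro v hv
    have := hρ hq.gen v hv
    rwa [kramersDoublet_ρ, show ((hq.gen : siteGroup s q) : DoubleSpaceGroup s).pt.val = 1 from rfl,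
      pow_one, kramersM_mulVec] at this
  have hΘ' : ∀ v ∈ V, ![-star (v 1), star (v 0)] ∈ V := by
    intro v hv
    have : kramersΘ *ᵥ star v ∈ V := hΘ v hv
    rwa [kramersΘ_mulVec] at this
  obtain ⟨v, hv, hv0⟩ := V.ne_bot_iff.1 hV
  have hv1 : ![v 0, 0] ∈ V := by
    have := V.smul_mem (1 / 2) (V.sub_mem hv (V.smul_mem Complex.I (hM v hv)))
    convert! this using 1
    ext i
    fin_cases i
    · simp [vecHead, ← mul_assoc]; ring
    · simp [vecHead, vecTail, ← mul_assoc]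
  have hv2 : ![0, v 1] ∈ V := by
    have := V.sub_mem hv hv1
    convert! this using 1
    ext i
    fin_cases i <;> simp
  have hc : ∃ c : ℂ, c ≠ 0 ∧ ![c, 0] ∈ V := by
    by_cases h0 : v 0 = 0
    · refine ⟨-star (v 1), fun h1 => hv0 ?_, ?_⟩
      · ext i
        fin_cases i
        · exact h0
        · simpa using! h1
      · convert! hΘ' _ hv2 using 1
        ext i
        fin_cases i <;> simp
    · exact ⟨v 0, h0, hv1⟩
  obtain ⟨c, hc0, hcV⟩ := hc
  have hcV' : ![0, star c] ∈ V := by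
    convert! hΘ' _ hcV using 1
    ext i
    fin_cases i <;> simp
  refine V.eq_top_iff'.2 fun w => ?_
  have := V.add_mem (V.smul_mem (w 0 / c) hcV) (V.smul_mem (w 1 / star c) hcV')
  convert! this using 1
  have hc1 : star c ≠ 0 := star_ne_zero.2 hc0
  ext i
  fin_cases i
  · simp [hc0]
  · simp only [Fin.mk_one, Pi.add_apply, Pi.smul_apply, Matrix.cons_val_one,
      smul_eq_mul, mul_zero, zero_add, Matrix.cons_val_fin_one]
    field_simp

end Std

section Unique

variable {s : Fin 3 → ℤˣ} {q : Fin 3 → ℝ} {m : Fin 3 → ℤ} {n : ℕ}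

lemma IsSymmetricSite.ρ_gen_mul_self (hq : IsSymmetricSite s q m) (τ : KramersRep s q n) :
    τ.ρ hq.gen * τ.ρ hq.gen = -1 := by
  rw [← map_mul, ← pow_two]
  refine τ.double_valued _ (eq_of_mem_siteGroup (hq.gen ^ 2).2 spinFlip_mem_siteGroup ?_)
  rw [hq.gen_pow_pt]
  rfl

lemma mulVec_star_star (M : Matrix (Fin n) (Fin n) ℂ) (v : Fin n → ℂ) :
    star (M *ᵥ star v) = cconj M *ᵥ v := by
  ext i; simp [Matrix.mulVec, dotProduct]

lemma star_mulVec_eq (M : Matrix (Fin n) (Fin n) ℂ) (v : Fin n → ℂ) :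
    star (M *ᵥ v) = cconj M *ᵥ star v := by
  ext i; simp [Matrix.mulVec, dotProduct]

open scoped ComplexOrder in
/-- Every irreducible representation at a symmetric site is the Kramers doublet: an eigenvector of
the generator with eigenvalue `i` and its time reversal, which has the eigenvalue `-i`, span an
invariant subspace. -/
lemma equivalent_kramersDoublet (hq : IsSymmetricSite s q m) (τ : KramersRep s q n)
    (hτ : τ.IsIrreducible) : τ.Equivalent (kramersDoublet s q) := by
  set M := τ.ρ hq.gen with hM
  have hMM : M * M = -1 := hq.ρ_gen_mul_self τ
  have hMMv : ∀ v, M *ᵥ (M *ᵥ v) = -v := fun v => by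
    rw [Matrix.mulVec_mulVec, hMM, Matrix.neg_mulVec, Matrix.one_mulVec]
  have hMT : ∀ v, M *ᵥ (τ.Θ *ᵥ star v) = τ.Θ *ᵥ star (M *ᵥ v) := fun v => by
    rw [star_mulVec_eq, Matrix.mulVec_mulVec, Matrix.mulVec_mulVec, τ.comm]
  have hTT : ∀ v, τ.Θ *ᵥ star (τ.Θ *ᵥ star v) = -v := fun v => by
    rw [mulVec_star_star, Matrix.mulVec_mulVec, τ.sq, Matrix.neg_mulVec, Matrix.one_mulVec]
  obtain ⟨v, hv0, hv⟩ : ∃ v : Fin n → ℂ, v ≠ 0 ∧ M *ᵥ v = Complex.I • v := by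
    let w : Fin n → ℂ := fun _ => 1
    have hw : w ≠ 0 := fun h => one_ne_zero (congrFun h ⟨0, hτ.1⟩)
    by_cases h : M *ᵥ w = -Complex.I • w
    · refine ⟨τ.Θ *ᵥ star w, fun h0 => hw ?_, ?_⟩
      · have := hTT w
        rw [h0] at this
        simpa using! this.symm
      · rw [hMT, h]
        simp [Matrix.mulVec_smul]
    · refine ⟨M *ᵥ w + Complex.I • w, fun h0 => h ?_, ?_⟩
      · rw [neg_smul]; exact eq_neg_of_add_eq_zero_left h0
      · rw [Matrix.mulVec_add, hMMv, Matrix.mulVec_smul, smul_add, smul_smul, Complex.I_mul_I,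
          neg_one_smul, add_comm]
  obtain ⟨v, hv1, hv⟩ : ∃ v : Fin n → ℂ, star v ⬝ᵥ v = 1 ∧ M *ᵥ v = Complex.I • v := by
    have hpos : 0 < (star v ⬝ᵥ v) := Matrix.dotProduct_star_self_pos_iff.2 hv0
    obtain ⟨r, hr⟩ : ∃ r : ℝ, star v ⬝ᵥ v = (r : ℂ) :=
      ⟨(star v ⬝ᵥ v).re, by
        rw [← Complex.re_add_im (star v ⬝ᵥ v), (Complex.pos_iff.1 hpos).2.symm]; simp⟩
    have hr0 : 0 < r := by rw [hr] at hpos; exact_mod_cast hpos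
    refine ⟨((Real.sqrt r)⁻¹ : ℂ) • v, ?_, by rw [Matrix.mulVec_smul, hv, smul_comm]⟩
    rw [star_smul, smul_dotProduct, dotProduct_smul, hr, smul_smul]
    have : ((Real.sqrt r : ℝ) : ℂ) * (Real.sqrt r : ℝ) = r := by
      exact_mod_cast Real.mul_self_sqrt hr0.le
    have h0 : ((Real.sqrt r : ℝ) : ℂ) ≠ 0 := by exact_mod_cast (Real.sqrt_pos.2 hr0).ne'
    simp only [star_inv₀, RCLike.star_def, Complex.conj_ofReal, smul_eq_mul]
    rw [← this]
    field_simp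
  set w := τ.Θ *ᵥ star v with hw
  have hMw : M *ᵥ w = -Complex.I • w := by
    rw [hw, hMT, hv]
    simp [Matrix.mulVec_smul, Matrix.mulVec_neg]
  have hww : star w ⬝ᵥ w = 1 := by
    rw [hw, Matrix.star_mulVec, star_star, Matrix.dotProduct_mulVec, Matrix.vecMul_vecMul,
      τ.unitary_Θ.1, Matrix.vecMul_one, dotProduct_comm, hv1]
  have hvw : star v ⬝ᵥ w = 0 := by
    have h1 : star (M *ᵥ v) ⬝ᵥ (M *ᵥ w) = star v ⬝ᵥ w := by
      rw [Matrix.star_mulVec, Matrix.dotProduct_mulVec, Matrix.vecMul_vecMul,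
        (τ.unitary_ρ hq.gen).1, Matrix.vecMul_one]
    rw [hv, hMw, star_smul, smul_dotProduct, dotProduct_smul, smul_smul] at h1
    simp at h1
    linear_combination -(1 / 2) * h1
  have hwv : star w ⬝ᵥ v = 0 := by
    have := congrArg star hvw
    rwa [star_dotProduct, star_star, star_zero] at this
  let P : Matrix (Fin n) (Fin 2) ℂ := Matrix.of fun i j => ![v i, w i] j
  have hPv : ∀ x, P *ᵥ x = x 0 • v + x 1 • w := by
    intro x; ext i; simp [P, Matrix.mulVec, dotProduct, Fin.sum_univ_two]; ring
  have hP1 : Pᴴ * P = 1 := by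
    ext i j
    have e : (Pᴴ * P) i j = star (fun k => P k i) ⬝ᵥ fun k => P k j := rfl
    rw [e]
    fin_cases i <;> fin_cases j
    · exact hv1
    · exact hvw
    · exact hwv
    · exact hww
  have hPM : M * P = P * kramersM := by
    refine Matrix.ext_of_mulVec_single fun j => ?_
    rw [← Matrix.mulVec_mulVec, ← Matrix.mulVec_mulVec, hPv, hPv, Matrix.mulVec_add,
      Matrix.mulVec_smul, Matrix.mulVec_smul, hv, hMw, kramersM_mulVec]
    simp [smul_smul, mul_comm]
  have hPΘ : τ.Θ * cconj P = P * kramersΘ := by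
    refine Matrix.ext_of_mulVec_single fun j => ?_
    have e : ∀ x : Fin 2 → ℂ, cconj P *ᵥ x = x 0 • star v + x 1 • star w := by
      intro x; ext i; simp [P, Matrix.mulVec, dotProduct, Fin.sum_univ_two]; ring
    rw [← Matrix.mulVec_mulVec, ← Matrix.mulVec_mulVec, hPv, e, Matrix.mulVec_add,
      Matrix.mulVec_smul, Matrix.mulVec_smul, ← hw, hw, hTT, ← hw, kramersΘ_mulVec]
    simp [add_comm]
  have hPρ : ∀ h, τ.ρ h * P = P * (kramersDoublet s q).ρ h := by
    intro h
    rw [kramersDoublet_ρ, hq.eq_gen_pow h, map_pow, ← hM, hq.gen_pow_pt, ZMod.natCast_zmod_val]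
    generalize (h : DoubleSpaceGroup s).pt.val = k
    induction k with
    | zero => simp
    | succ k ih => rw [pow_succ, Matrix.mul_assoc, hPM, ← Matrix.mul_assoc, ih, pow_succ,
        Matrix.mul_assoc]
  have hrange : LinearMap.range P.mulVecLin = ⊤ := by
    refine (hτ.2 _ ?_ ?_).resolve_left ?_
    · rintro h _ ⟨x, rfl⟩
      exact ⟨(kramersDoublet s q).ρ h *ᵥ x, by
        simp only [Matrix.mulVecLin_apply, Matrix.mulVec_mulVec, hPρ]⟩
    · rintro _ ⟨x, rfl⟩
      refine ⟨kramersΘ *ᵥ star x, ?_⟩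
      have e : star (P *ᵥ x) = cconj P *ᵥ star x := by
        ext i; simp [Matrix.mulVec, dotProduct]
      rw [Matrix.mulVecLin_apply, Matrix.mulVecLin_apply, Matrix.mulVec_mulVec, ← hPΘ, e,
        Matrix.mulVec_mulVec]
    · intro h
      have : P *ᵥ ![1, 0] ∈ LinearMap.range P.mulVecLin := ⟨_, rfl⟩
      rw [h, Submodule.mem_bot, hPv] at this
      simp at this
      simp [this] at hv1
  have hP2 : P * Pᴴ = 1 := by
    refine Matrix.ext_of_mulVec_single fun j => ?_
    obtain ⟨y, hy⟩ : Pi.single j 1 ∈ LinearMap.range P.mulVecLin := hrange ▸ Submodule.mem_top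
    rw [← hy, Matrix.mulVecLin_apply, Matrix.mulVec_mulVec, Matrix.mul_assoc, hP1, Matrix.mul_one,
      Matrix.one_mulVec]
  refine ⟨Pᴴ, ⟨by simpa using! hP2, by simpa using! hP1⟩, fun h => ?_, ?_⟩
  · rw [← Matrix.mul_one (Pᴴ * _), ← hP2, Matrix.mul_assoc, ← Matrix.mul_assoc _ P, hPρ,
      Matrix.mul_assoc, ← Matrix.mul_assoc, hP1, Matrix.one_mul]
  · have hc : cconj P * cconj Pᴴ = 1 := by rw [← cconj_mul, hP2, cconj_one]
    rw [← Matrix.mul_one (Pᴴ * _), ← hc, Matrix.mul_assoc, ← Matrix.mul_assoc _ (cconj P), hPΘ,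
      Matrix.mul_assoc, ← Matrix.mul_assoc, hP1, Matrix.one_mul]
    rfl

lemma hasUniqueKramersIrrep (hq : IsSymmetricSite s q m) : HasUniqueKramersIrrep s q :=
  ⟨kramersDoublet s q, kramersDoublet_isIrreducible hq,
    fun _ τ' hτ' => equivalent_kramersDoublet hq τ' hτ'⟩

end Unique

/-! ### Phases and the matrices of band representations -/

section Phase

/-- The plane wave `e^{-i k·r}`. -/
noncomputable def planeWave (k r : Fin 3 → ℝ) : ℂ :=
  Complex.exp (-Complex.I * ((∑ i, k i * r i : ℝ) : ℂ))

variable {k k' r r' : Fin 3 → ℝ} {s : Fin 3 → ℤˣ}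

lemma planeWave_add_left : planeWave (k + k') r = planeWave k r * planeWave k' r := by
  rw [planeWave, planeWave, planeWave, ← Complex.exp_add]
  congr 1
  simp only [Pi.add_apply, add_mul, Finset.sum_add_distrib]
  push_cast
  ring

lemma planeWave_add_right : planeWave k (r + r') = planeWave k r * planeWave k r' := by
  rw [planeWave, planeWave, planeWave, ← Complex.exp_add]
  congr 1
  simp only [Pi.add_apply, mul_add, Finset.sum_add_distrib]
  push_cast
  ring

@[simp] lemma planeWave_zero_left : planeWave 0 r = 1 := by simp [planeWave]

@[simp] lemma planeWave_zero_right : planeWave k 0 = 1 := by simp [planeWave]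

lemma conj_planeWave : conj (planeWave k r) = planeWave (-k) r := by
  rw [planeWave, planeWave, ← Complex.exp_conj]
  simp

lemma planeWave_neg_right : planeWave k (-r) = planeWave (-k) r := by simp [planeWave]

lemma planeWave_neg_mul : planeWave (-k) r * planeWave k r = 1 := by
  rw [← planeWave_add_left, neg_add_cancel, planeWave_zero_left]

lemma conj_planeWave_mul : conj (planeWave k r) * planeWave k r = 1 := by
  rw [conj_planeWave, planeWave_neg_mul]

lemma MomentumEquiv.planeWave_eq (h : MomentumEquiv k k') (n : Fin 3 → ℤ) :
    planeWave k' (fun i => (n i : ℝ)) = planeWave k fun i => (n i : ℝ) := by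
  obtain ⟨m, hm⟩ := h
  rw [planeWave, planeWave, Complex.exp_eq_exp_iff_exists_int]
  refine ⟨-∑ i, m i * n i, ?_⟩
  simp only [hm, Fin.sum_univ_three]
  push_cast
  ring

lemma MomentumEquiv.rot (h : MomentumEquiv k k') (g : DoubleSpaceGroup s) :
    MomentumEquiv (g.rot k) (g.rot k') := by
  obtain ⟨m, hm⟩ := h
  refine ⟨fun i => sign s g.pt i * m i, fun i => ?_⟩
  simp only [DoubleSpaceGroup.rot, hm i]
  push_cast
  ring

lemma planeWave_rot_act (g : DoubleSpaceGroup s) (k r : Fin 3 → ℝ) :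
    planeWave (rot g k) (act g r) = planeWave k r * planeWave (rot g k) fun i => (g.tr i : ℝ) := by
  have e : act g r = (fun i => (sign s g.pt i : ℝ) * r i) + fun i => (g.tr i : ℝ) := rfl
  rw [e, planeWave_add_right]
  congr 1
  rw [planeWave, planeWave]
  congr 3
  refine Finset.sum_congr rfl fun i _ => ?_
  have : (sign s g.pt i : ℝ) * sign s g.pt i = 1 := by exact_mod_cast sign_mul_self g.pt i
  simp only [rot]
  linear_combination k i * r i * this

lemma rot_neg (g : DoubleSpaceGroup s) (k : Fin 3 → ℝ) : rot g (-k) = -rot g k := by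
  ext i; simp [rot]

end Phase

lemma KramersRep.Θ_transpose {s : Fin 3 → ℤˣ} {q : Fin 3 → ℝ} {n : ℕ} (τ : KramersRep s q n) :
    τ.Θᵀ = -τ.Θ := by
  have h : cconj τ.Θ = -τ.Θᴴ := by
    rw [← Matrix.one_mul (cconj τ.Θ), ← τ.unitary_Θ.1, Matrix.mul_assoc, τ.sq, Matrix.mul_neg,
      Matrix.mul_one]
  have := congrArg cconj h
  rw [cconj_cconj, cconj_neg, cconj_conjTranspose] at this
  rw [← neg_eq_iff_eq_neg.2 this]

namespace Shell

variable {s : Fin 3 → ℤˣ} (a : Shell s)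

/-- The element `g_β⁻¹ {E | -t_βα(h)} h g_α`, which is in the site-symmetry group if `h` maps
the site of `α` to a translate of the site of `β`. -/
noncomputable def transfer (h : DoubleSpaceGroup s) (β α : Fin a.mult) : DoubleSpaceGroup s :=
  (a.cosetRep β)⁻¹ * transl (-a.shift h β α) * h * a.cosetRep α

lemma act_transl (t : Fin 3 → ℤ) (r : Fin 3 → ℝ) :
    act (transl t : DoubleSpaceGroup s) r = r + fun i => (t i : ℝ) := by
  ext i
  change (sign s 0 i : ℝ) * r i + (t i : ℝ) = _
  simp [sign_zero]

lemma transl_mul_transl_neg (t : Fin 3 → ℤ) :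
    (transl t * transl (-t) : DoubleSpaceGroup s) = 1 := by
  ext i
  · rfl
  · change t i + sign s 0 i * -t i = 0
    simp [sign_zero]

lemma transl_neg (t : Fin 3 → ℤ) : (transl (-t) : DoubleSpaceGroup s) = (transl t)⁻¹ :=
  (inv_eq_of_mul_eq_one_right (transl_mul_transl_neg t)).symm

variable {a}

lemma shift_eq {h : DoubleSpaceGroup s} {β α : Fin a.mult} {t : Fin 3 → ℤ}
    (ht : act h (a.pos α) = a.pos β + fun i => (t i : ℝ)) : a.shift h β α = t := by
  ext i
  simp [shift, ht]

/-- Membership of `transfer` in the site-symmetry group expresses that `h g_α` is in the coset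
of `g_β`; so `block k h` is a permutation of the sites with unitary entries. -/
lemma transfer_mem_iff {h : DoubleSpaceGroup s} {β α : Fin a.mult} :
    a.transfer h β α ∈ siteGroup s a.site ↔
      ∃ t : Fin 3 → ℤ, ∃ x ∈ siteGroup s a.site,
        h * a.cosetRep α = transl t * a.cosetRep β * x := by
  constructor
  · intro hx
    refine ⟨a.shift h β α, _, hx, ?_⟩
    rw [transfer, transl_neg]
    group
  · rintro ⟨t, x, hx, e⟩
    have ht : a.shift h β α = t := by
      refine shift_eq ?_
      have hx' : act x a.site = a.site := hx
      rw [pos, pos, ← act_mul, e, act_mul, act_mul, hx', act_transl]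
    have : a.transfer h β α = x := by
      rw [transfer, ht, transl_neg, mul_assoc, e]
      group
    rwa [this]

lemma act_pos_of_mem {h : DoubleSpaceGroup s} {β α : Fin a.mult}
    (hx : a.transfer h β α ∈ siteGroup s a.site) :
    act h (a.pos α) = a.pos β + fun i => (a.shift h β α i : ℝ) := by
  have e : h * a.cosetRep α
      = transl (a.shift h β α) * a.cosetRep β * a.transfer h β α := by
    rw [transfer, transl_neg]; group
  have hx' : act (a.transfer h β α) a.site = a.site := hx
  rw [pos, pos, ← act_mul, e, act_mul, act_mul, hx', act_transl]

lemma exists_transfer_mem (h : DoubleSpaceGroup s) (α : Fin a.mult) :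
    ∃ β, a.transfer h β α ∈ siteGroup s a.site := by
  obtain ⟨β, ⟨t, x, hx, e⟩, -⟩ := a.cosets (h * a.cosetRep α)
  exact ⟨β, transfer_mem_iff.2 ⟨t, x, hx, e⟩⟩

lemma transfer_mem_unique_left {h : DoubleSpaceGroup s} {β β' α : Fin a.mult}
    (hβ : a.transfer h β α ∈ siteGroup s a.site) (hβ' : a.transfer h β' α ∈ siteGroup s a.site) :
    β = β' :=
  (a.cosets (h * a.cosetRep α)).unique (transfer_mem_iff.1 hβ) (transfer_mem_iff.1 hβ')

lemma exists_mul_transl (h : DoubleSpaceGroup s) (t : Fin 3 → ℤ) :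
    ∃ t' : Fin 3 → ℤ, h * transl t = transl t' * h := by
  refine ⟨fun i => sign s h.pt i * t i, ?_⟩
  ext i
  · change h.pt + 0 = 0 + h.pt
    simp
  · change h.tr i + sign s h.pt i * t i = sign s h.pt i * t i + sign s 0 i * h.tr i
    rw [sign_zero]; ring

lemma transfer_mem_unique_right {h : DoubleSpaceGroup s} {β α α' : Fin a.mult}
    (hα : a.transfer h β α ∈ siteGroup s a.site) (hα' : a.transfer h β α' ∈ siteGroup s a.site) :
    α = α' := by
  obtain ⟨t, x, hx, e⟩ := transfer_mem_iff.1 hα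
  obtain ⟨t', x', hx', e'⟩ := transfer_mem_iff.1 hα'
  obtain ⟨u, hu⟩ := exists_mul_transl h⁻¹ (t' - t)
  have key : a.cosetRep α' = transl u * a.cosetRep α * (x⁻¹ * x') := by
    have h1 : (transl t' : DoubleSpaceGroup s) = transl (t' - t) * transl t := by
      ext i
      · rfl
      · change t' i = (t' - t) i + sign s 0 i * t i
        simp [sign_zero]
    have h2 : a.cosetRep α' = h⁻¹ * (transl t' * a.cosetRep β * x') := by rw [← e']; group
    have h3 : transl t * a.cosetRep β = h * a.cosetRep α * x⁻¹ := by rw [e]; group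
    rw [h2, h1, mul_assoc (transl (t' - t)), h3, ← mul_assoc, ← mul_assoc, hu]
    group
  refine (a.cosets (a.cosetRep α')).unique ⟨u, _, mul_mem (inv_mem hx) hx', key⟩
    ⟨0, 1, one_mem _, ?_⟩
  have : (transl 0 : DoubleSpaceGroup s) = 1 := rfl
  rw [this, one_mul, mul_one]

lemma block_apply (k : Fin 3 → ℝ) (h : DoubleSpaceGroup s) (x y : Fin a.mult × Fin a.dim) :
    a.block k h x y = planeWave (rot h k) (fun i => (a.shift h x.1 y.1 i : ℝ)) *
      a.rep.extend (a.transfer h x.1 y.1) x.2 y.2 := rfl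

lemma block_eq_zero {k : Fin 3 → ℝ} {h : DoubleSpaceGroup s} {x y : Fin a.mult × Fin a.dim}
    (hx : a.transfer h x.1 y.1 ∉ siteGroup s a.site) : a.block k h x y = 0 := by
  rw [block_apply, KramersRep.extend, dif_neg hx]
  simp

lemma conjTranspose_block_mul_block (k : Fin 3 → ℝ) (h : DoubleSpaceGroup s) :
    (a.block k h)ᴴ * a.block k h = 1 := by
  ext ⟨α, i⟩ ⟨α', j⟩
  rw [Matrix.mul_apply, Fintype.sum_prod_type]
  simp only [conjTranspose_apply]
  obtain ⟨β, hβ⟩ := exists_transfer_mem h α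
  rw [Finset.sum_eq_single β]
  · by_cases hα : α = α'
    · subst hα
      have e : ∀ l l', a.block k h (β, l) (α, l') =
          planeWave (rot h k) (fun i => (a.shift h β α i : ℝ)) * a.rep.ρ ⟨_, hβ⟩ l l' := by
        intro l l'
        rw [block_apply, KramersRep.extend, dif_pos hβ]
      have h1 := congrFun (congrFun (a.rep.unitary_ρ ⟨_, hβ⟩).1 i) j
      rw [Matrix.mul_apply] at h1
      have h2 := conj_planeWave_mul (k := rot h k) (r := fun i => (a.shift h β α i : ℝ))
      calc _ = ∑ l, (a.rep.ρ ⟨_, hβ⟩)ᴴ i l * a.rep.ρ ⟨_, hβ⟩ l j := by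
            refine Finset.sum_congr rfl fun l _ => ?_
            rw [e, e, star_mul', conjTranspose_apply]
            simp only [starRingEnd_apply] at h2
            linear_combination star (a.rep.ρ ⟨_, hβ⟩ l i) * a.rep.ρ ⟨_, hβ⟩ l j * h2
        _ = _ := by rw [h1]; simp [Matrix.one_apply]
    · have hα' : (1 : Matrix (Fin a.mult × Fin a.dim) (Fin a.mult × Fin a.dim) ℂ)
          (α, i) (α', j) = 0 := Matrix.one_apply_ne (by simp [hα])
      rw [hα']
      refine Finset.sum_eq_zero fun l _ => ?_
      have hn : a.transfer h β α' ∉ siteGroup s a.site := fun hx =>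
        hα (transfer_mem_unique_right hβ hx)
      rw [block_eq_zero (x := (β, l)) (y := (α', j)) hn, mul_zero]
  · intro β' _ hne
    refine Finset.sum_eq_zero fun l _ => ?_
    have hn : a.transfer h β' α ∉ siteGroup s a.site := fun hx =>
      hne (transfer_mem_unique_left hx hβ)
    rw [block_eq_zero (x := (β', l)) (y := (α, i)) hn, star_zero, zero_mul]
  · simp

lemma block_eq_of_momentumEquiv {k k' : Fin 3 → ℝ} (hk : MomentumEquiv k k')
    (h : DoubleSpaceGroup s) : a.block k' h = a.block k h := by
  ext x y
  rw [block_apply, block_apply, (hk.rot h).planeWave_eq]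

/-- The phases of `block` are those of the plane waves at the sites, as `h` maps the site of `y` to
a translate of the site of `x` by the lattice vector `shift`. -/
lemma planeWave_mul_block (k : Fin 3 → ℝ) (h : DoubleSpaceGroup s)
    (x y : Fin a.mult × Fin a.dim) :
    planeWave (rot h k) (a.pos x.1) * a.block k h x y =
      planeWave (rot h k) (fun i => (h.tr i : ℝ)) * a.block 0 h x y * planeWave k (a.pos y.1) := by
  by_cases hx : a.transfer h x.1 y.1 ∈ siteGroup s a.site
  · have h1 := planeWave_rot_act h k (a.pos y.1)
    rw [act_pos_of_mem hx, planeWave_add_right] at h1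
    have h0 : rot h 0 = 0 := by ext i; simp [rot]
    rw [block_apply, block_apply, h0, planeWave_zero_left, one_mul, ← mul_assoc, h1]
    ring
  · rw [block_eq_zero hx, block_eq_zero hx]; simp

lemma trBlock_eq_kronecker : a.trBlock = Matrix.kroneckerMap (· * ·) 1 a.rep.Θ := by
  ext x y
  simp [trBlock, Matrix.one_apply]

lemma isUnitaryMatrix_trBlock : IsUnitaryMatrix a.trBlock := by
  refine isUnitaryMatrix_of_mul ?_
  rw [trBlock_eq_kronecker, Matrix.conjTranspose_kronecker, ← Matrix.mul_kronecker_mul,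
    a.rep.unitary_Θ.1]
  simp

lemma trBlock_transpose : a.trBlockᵀ = -a.trBlock := by
  ext x y
  have := congrFun (congrFun a.rep.Θ_transpose x.2) y.2
  simp only [transpose_apply, Matrix.neg_apply] at this
  by_cases h : x.1 = y.1
  · simp [trBlock, h, this]
  · simp [trBlock, h, Ne.symm h]

end Shell

namespace BandRep

variable {s : Fin 3 → ℤˣ} (B : BandRep s)

lemma isUnitaryMatrix_block (k : Fin 3 → ℝ) (h : DoubleSpaceGroup s) :
    IsUnitaryMatrix (B.block k h) := by
  refine isUnitaryMatrix_of_mul ?_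
  rw [block, Matrix.blockDiagonal'_conjTranspose, ← Matrix.blockDiagonal'_mul]
  simp only [Shell.conjTranspose_block_mul_block]
  exact Matrix.blockDiagonal'_one

lemma isUnitaryMatrix_trBlock : IsUnitaryMatrix B.trBlock := by
  refine isUnitaryMatrix_of_mul ?_
  rw [trBlock, Matrix.blockDiagonal'_conjTranspose, ← Matrix.blockDiagonal'_mul]
  simp only [Shell.isUnitaryMatrix_trBlock.1]
  exact Matrix.blockDiagonal'_one

lemma trBlock_transpose : B.trBlockᵀ = -B.trBlock := by
  rw [trBlock, Matrix.blockDiagonal'_transpose]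
  simp only [Shell.trBlock_transpose]
  exact Matrix.blockDiagonal'_neg _

lemma block_eq_of_momentumEquiv {k k' : Fin 3 → ℝ} (hk : MomentumEquiv k k')
    (h : DoubleSpaceGroup s) : B.block k' h = B.block k h := by
  rw [block, block]
  simp only [Shell.block_eq_of_momentumEquiv hk]

/-- The unitary matrix that maps Bloch states at `k` to their cell-periodic parts. -/
noncomputable def cellPhase (k : Fin 3 → ℝ) : Matrix B.Index B.Index ℂ :=
  Matrix.diagonal fun x => planeWave k (B.pos x)

lemma cellPeriodic_eq {N : ℕ} (k : Fin 3 → ℝ) (ψ : Matrix B.Index (Fin N) ℂ) :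
    cellPeriodic B k ψ = B.cellPhase k * ψ := by
  ext x m
  rw [cellPhase, Matrix.diagonal_mul]
  rfl

lemma cellPhase_add (k k' : Fin 3 → ℝ) :
    B.cellPhase (k + k') = B.cellPhase k * B.cellPhase k' := by
  rw [cellPhase, cellPhase, cellPhase, Matrix.diagonal_mul_diagonal]
  simp only [planeWave_add_left]

@[simp] lemma cellPhase_zero : B.cellPhase 0 = 1 := by
  simp [cellPhase]

lemma cconj_cellPhase (k : Fin 3 → ℝ) : cconj (B.cellPhase k) = B.cellPhase (-k) := by
  ext x y
  by_cases h : x = y <;> simp [cellPhase, h, conj_planeWave]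

lemma conjTranspose_cellPhase (k : Fin 3 → ℝ) : (B.cellPhase k)ᴴ = B.cellPhase (-k) := by
  rw [← cconj_cellPhase, ← cconj_transpose]
  simp [cellPhase]

lemma isUnitaryMatrix_cellPhase (k : Fin 3 → ℝ) : IsUnitaryMatrix (B.cellPhase k) := by
  refine isUnitaryMatrix_of_mul ?_
  rw [conjTranspose_cellPhase, ← cellPhase_add, neg_add_cancel, cellPhase_zero]

/-- For the cell-periodic parts, a symmetry that fixes the origin acts by a matrix which does not
depend on the momentum. -/
lemma cellPhase_mul_block (k : Fin 3 → ℝ) {h : DoubleSpaceGroup s} (h0 : h.tr = 0) :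
    B.cellPhase (rot h k) * B.block k h = B.block 0 h * B.cellPhase k := by
  ext ⟨c, x⟩ ⟨c', y⟩
  rw [cellPhase, cellPhase, Matrix.diagonal_mul, Matrix.mul_diagonal, block, block]
  by_cases hc : c = c'
  · subst hc
    rw [Matrix.blockDiagonal'_apply_eq, Matrix.blockDiagonal'_apply_eq]
    have := Shell.planeWave_mul_block (a := B.shell c) k h x y
    have e : (fun i => (h.tr i : ℝ)) = 0 := by ext i; simp [h0]
    rwa [e, planeWave_zero_right, one_mul] at this
  · rw [Matrix.blockDiagonal'_apply_ne _ _ _ hc, Matrix.blockDiagonal'_apply_ne _ _ _ hc]; simp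

lemma trBlock_mul_cconj_cellPhase (k : Fin 3 → ℝ) :
    B.trBlock * cconj (B.cellPhase k) = B.cellPhase (-k) * B.trBlock := by
  rw [cconj_cellPhase]
  ext ⟨c, x⟩ ⟨c', y⟩
  rw [cellPhase, Matrix.diagonal_mul, Matrix.mul_diagonal, trBlock]
  by_cases hc : c = c'
  · subst hc
    rw [Matrix.blockDiagonal'_apply_eq, Shell.trBlock, pos, pos]
    by_cases hxy : x.1 = y.1
    · simp only [hxy]; ring
    · simp [hxy]
  · rw [Matrix.blockDiagonal'_apply_ne _ _ _ hc]; simp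

end BandRep

/-! ### Symmetry of the bands -/

section Bands

lemma exists_mul_of_range_le {I m n : Type*} [Fintype m] [Fintype n] [DecidableEq n]
    {X : Matrix I m ℂ} {Y : Matrix I n ℂ}
    (h : LinearMap.range Y.mulVecLin ≤ LinearMap.range X.mulVecLin) :
    ∃ Z : Matrix m n ℂ, Y = X * Z := by
  have h' : ∀ j, ∃ z : m → ℂ, X *ᵥ z = Y.col j := fun j => by
    obtain ⟨z, hz⟩ := h ⟨Pi.single j 1, rfl⟩
    exact ⟨z, by simpa using! hz⟩
  choose z hz using h'
  refine ⟨Matrix.of fun i j => z j i, ?_⟩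
  ext i j
  exact (congrFun (hz j) i).symm

lemma eigenvalues₀_eq_of_charpoly_eq {n : Type*} [Fintype n] [DecidableEq n] {M N : Matrix n n ℂ}
    (hM : M.IsHermitian) (hN : N.IsHermitian) (h : M.charpoly = N.charpoly) :
    hM.eigenvalues₀ = hN.eigenvalues₀ := by
  have h1 := hM.sort_roots_charpoly_eq_eigenvalues₀
  rw [h, hN.sort_roots_charpoly_eq_eigenvalues₀] at h1
  exact (List.ofFn_injective h1).symm

variable {s : Fin 3 → ℤˣ} {B : BandRep s} (𝓗 : BlochHamiltonian B) {k k' : Fin 3 → ℝ}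
  {𝓑 : Finset (Fin (Fintype.card B.Index))}

namespace BlochHamiltonian

lemma charpoly_eq_of_conj {U H H' : Matrix B.Index B.Index ℂ} (hU : IsUnitaryMatrix U)
    (h : U * H = H' * U) : H'.charpoly = H.charpoly := by
  have e : H' = U * (H * Uᴴ) := by
    rw [← Matrix.mul_assoc, h, Matrix.mul_assoc, hU.2, Matrix.mul_one]
  rw [e, Matrix.charpoly_mul_comm, Matrix.mul_assoc, hU.1, Matrix.mul_one]

lemma energy_rot (h : DoubleSpaceGroup s) (k : Fin 3 → ℝ) :
    𝓗.energy (rot h k) = 𝓗.energy k :=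
  eigenvalues₀_eq_of_charpoly_eq _ _
    (charpoly_eq_of_conj (B.isUnitaryMatrix_block k h) (𝓗.symm k h))

lemma energy_neg (k : Fin 3 → ℝ) : 𝓗.energy (-k) = 𝓗.energy k := by
  refine eigenvalues₀_eq_of_charpoly_eq _ _ ?_
  rw [charpoly_eq_of_conj B.isUnitaryMatrix_trBlock (𝓗.time_reversal k)]
  have : cconj (𝓗.H k) = (𝓗.H k)ᵀ := by
    rw [← cconj_conjTranspose, (𝓗.hermitian k).eq]
  rw [this, Matrix.charpoly_transpose]

lemma bandSpace_eq_of_momentumEquiv (hk : MomentumEquiv k k') :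
    𝓗.bandSpace 𝓑 k' = 𝓗.bandSpace 𝓑 k := by
  have h := 𝓗.periodic k k' hk
  have e : 𝓗.energy k' = 𝓗.energy k := eigenvalues₀_eq_of_charpoly_eq _ _ (by rw [h])
  rw [bandSpace, bandSpace, h, e]

lemma range_block_mul_le {n : Type*} [Fintype n] {X : Matrix B.Index n ℂ}
    (hX : LinearMap.range X.mulVecLin ≤ 𝓗.bandSpace 𝓑 k) (h : DoubleSpaceGroup s) :
    LinearMap.range (B.block k h * X).mulVecLin ≤ 𝓗.bandSpace 𝓑 (rot h k) := by
  have key : 𝓗.bandSpace 𝓑 k ≤ (𝓗.bandSpace 𝓑 (rot h k)).comap (B.block k h).mulVecLin := by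
    refine Submodule.span_le.2 ?_
    rintro v ⟨b, hb, hv⟩
    refine Submodule.subset_span ⟨b, hb, ?_⟩
    rw [Matrix.mulVecLin_apply, Matrix.mulVec_mulVec, ← 𝓗.symm, ← Matrix.mulVec_mulVec, hv,
      Matrix.mulVec_smul, 𝓗.energy_rot]
  rintro _ ⟨x, rfl⟩
  rw [Matrix.mulVecLin_apply, ← Matrix.mulVec_mulVec]
  exact key (hX ⟨x, rfl⟩)

lemma range_trBlock_mul_cconj_le {n : Type*} [Fintype n] {X : Matrix B.Index n ℂ}
    (hX : LinearMap.range X.mulVecLin ≤ 𝓗.bandSpace 𝓑 k) :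
    LinearMap.range (B.trBlock * cconj X).mulVecLin ≤ 𝓗.bandSpace 𝓑 (-k) := by
  have key : ∀ v ∈ 𝓗.bandSpace 𝓑 k, B.trBlock *ᵥ star v ∈ 𝓗.bandSpace 𝓑 (-k) := by
    intro v hv
    induction hv using Submodule.span_induction with
    | mem v hv =>
      obtain ⟨b, hb, hv⟩ := hv
      refine Submodule.subset_span ⟨b, hb, ?_⟩
      have e : cconj (𝓗.H k) *ᵥ star v = (𝓗.energy k b : ℂ) • star v := by
        have := congrArg star hv
        rw [star_smul, Complex.star_def, Complex.conj_ofReal] at this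
        rw [← this]
        ext i; simp [Matrix.mulVec, dotProduct]
      rw [Matrix.mulVec_mulVec, ← 𝓗.time_reversal, ← Matrix.mulVec_mulVec, e, Matrix.mulVec_smul,
        𝓗.energy_neg]
    | zero => simp
    | add x y _ _ hx hy => rw [star_add, Matrix.mulVec_add]; exact add_mem hx hy
    | smul c x _ hx => rw [star_smul, Matrix.mulVec_smul]; exact Submodule.smul_mem _ _ hx
  rintro _ ⟨x, rfl⟩
  have e : cconj X *ᵥ x = star (X *ᵥ star x) := by
    ext i; simp [Matrix.mulVec, dotProduct]
  rw [Matrix.mulVecLin_apply, ← Matrix.mulVec_mulVec, e]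
  exact key _ (hX ⟨star x, rfl⟩)

end BlochHamiltonian

end Bands

/-! ### The Wilson loop along a line reversed by the point operation -/

section Line

variable {s : Fin 3 → ℤˣ}

lemma gLine_sub (j : Fin 3) (x y : ℝ) : gLine j (x - y) = gLine j x - gLine j y := by
  simp only [gLine, Pi.single_sub]

@[simp] lemma gLine_zero (j : Fin 3) : gLine j 0 = 0 := by simp [gLine]

lemma momentumEquiv_add_gLine (j : Fin 3) (k : Fin 3 → ℝ) :
    MomentumEquiv k (k + gLine j (2 * Real.pi)) := by
  refine ⟨Pi.single j 1, fun i => ?_⟩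
  by_cases h : i = j
  · subst h; simp [gLine]
  · simp [gLine, h]

lemma planeWave_gLine (j : Fin 3) (x : ℝ) (r : Fin 3 → ℝ) :
    planeWave (gLine j x) r = Complex.exp (-Complex.I * (x * r j : ℝ)) := by
  rw [planeWave]
  congr 3
  rw [Finset.sum_eq_single j]
  · simp [gLine]
  · intro i _ hi; simp [gLine, hi]
  · simp

/-- The point operation without translation. -/
def pointOp (s : Fin 3 → ℤˣ) : DoubleSpaceGroup s := ⟨1, 0⟩

lemma rot_pointOp_gLine {j : Fin 3} (hj : s j = -1) (x : ℝ) :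
    rot (pointOp s) (gLine j x) = -gLine j x := by
  ext i
  change (sign s 1 i : ℝ) * gLine j x i = - gLine j x i
  by_cases h : i = j
  · subst h; simp [sign_pt_one, hj]
  · simp [gLine, h]

variable {B : BandRep s} {𝓗 : BlochHamiltonian B} {𝓑 : Finset (Fin (Fintype.card B.Index))}
  {j : Fin 3} {N : ℕ}

/-- The cell-periodic parts along the line. -/
noncomputable def periodicFrame (B : BandRep s) (j : Fin 3) (ψ : ℝ → Matrix B.Index (Fin N) ℂ)
    (t : ℝ) : Matrix B.Index (Fin N) ℂ :=
  B.cellPhase (gLine j t) * ψ t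

/-- The derivative of the cell-periodic parts along the line. -/
noncomputable def periodicFrameDeriv (B : BandRep s) (j : Fin 3)
    (ψ : ℝ → Matrix B.Index (Fin N) ℂ) (t : ℝ) : Matrix B.Index (Fin N) ℂ :=
  fun x l => derivWithin (fun y => periodicFrame B j ψ y x l) (Icc 0 (2 * Real.pi)) t

lemma berryConnection_eq (ψ : ℝ → Matrix B.Index (Fin N) ℂ) :
    berryConnection B j ψ =
      fun t => Complex.I • ((periodicFrame B j ψ t)ᴴ * periodicFrameDeriv B j ψ t) := by
  ext t m l
  simp only [berryConnection, BandRep.cellPeriodic_eq]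
  rfl

lemma contDiffOn_periodicFrame {ψ : ℝ → Matrix B.Index (Fin N) ℂ}
    (hψ : ∀ x m, ContDiffOn ℝ 1 (fun t => ψ t x m) (Icc 0 (2 * Real.pi))) (x : B.Index)
    (m : Fin N) : ContDiffOn ℝ 1 (fun t => periodicFrame B j ψ t x m) (Icc 0 (2 * Real.pi)) := by
  simp only [periodicFrame, BandRep.cellPhase, Matrix.diagonal_mul, planeWave_gLine]
  refine ContDiffOn.mul (ContDiff.contDiffOn ?_) (hψ x m)
  exact (contDiff_const.mul (Complex.ofRealCLM.contDiff.comp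
    (contDiff_id.mul contDiff_const))).cexp

lemma IsBlochFrame.hasMatDeriv {ψ : ℝ → Matrix B.Index (Fin N) ℂ}
    (hψ : IsBlochFrame 𝓗 𝓑 j ψ) : ∀ t ∈ Icc 0 (2 * Real.pi),
      HasMatDeriv (periodicFrame B j ψ) (periodicFrameDeriv B j ψ t) (Icc 0 (2 * Real.pi)) t :=
  fun t ht x m => ((contDiffOn_periodicFrame hψ.1 x m).differentiableOn one_ne_zero t
    ht).hasDerivWithinAt

lemma IsBlochFrame.continuousOn_deriv {ψ : ℝ → Matrix B.Index (Fin N) ℂ}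
    (hψ : IsBlochFrame 𝓗 𝓑 j ψ) (x : B.Index) (m : Fin N) :
    ContinuousOn (fun t => periodicFrameDeriv B j ψ t x m) (Icc 0 (2 * Real.pi)) :=
  (contDiffOn_periodicFrame hψ.1 x m).continuousOn_derivWithin
    (uniqueDiffOn_Icc (by positivity)) le_rfl

lemma conjTranspose_periodicFrame_mul {ψ : ℝ → Matrix B.Index (Fin N) ℂ} {t : ℝ}
    (h : (ψ t)ᴴ * ψ t = 1) : (periodicFrame B j ψ t)ᴴ * periodicFrame B j ψ t = 1 := by
  rw [periodicFrame, conjTranspose_mul, Matrix.mul_assoc, ← Matrix.mul_assoc _ _ (ψ t),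
    (B.isUnitaryMatrix_cellPhase _).1, Matrix.one_mul, h]

lemma IsBlochFrame.iso {ψ : ℝ → Matrix B.Index (Fin N) ℂ} (hψ : IsBlochFrame 𝓗 𝓑 j ψ) :
    ∀ t ∈ Icc 0 (2 * Real.pi), (periodicFrame B j ψ t)ᴴ * periodicFrame B j ψ t = 1 :=
  fun t ht => conjTranspose_periodicFrame_mul (hψ.2.1 t ht).1

/-- The product of time reversal and the point operation acts on cell-periodic parts along the
line by a constant matrix. -/
lemma block_mul_trBlock_mul_cconj_periodicFrame (hj : s j = -1)
    (ψ : ℝ → Matrix B.Index (Fin N) ℂ) (t : ℝ) :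
    B.block 0 (pointOp s) * B.trBlock * cconj (periodicFrame B j ψ t) =
      B.cellPhase (gLine j t) * (B.block (-gLine j t) (pointOp s) * (B.trBlock * cconj (ψ t))) := by
  have e := B.cellPhase_mul_block (-gLine j t) (h := pointOp s) rfl
  rw [rot_neg, rot_pointOp_gLine hj, neg_neg] at e
  rw [periodicFrame, cconj_mul, Matrix.mul_assoc, ← Matrix.mul_assoc B.trBlock,
    B.trBlock_mul_cconj_cellPhase, Matrix.mul_assoc, ← Matrix.mul_assoc _ (B.cellPhase _), ← e,
    Matrix.mul_assoc]

lemma cellPhase_mul_trBlock_mul_cconj_periodicFrame (ψ : ℝ → Matrix B.Index (Fin N) ℂ) (t : ℝ) :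
    B.cellPhase (gLine j (2 * Real.pi)) * B.trBlock * cconj (periodicFrame B j ψ t) =
      B.cellPhase (gLine j (2 * Real.pi - t)) * (B.trBlock * cconj (ψ t)) := by
  rw [periodicFrame, cconj_mul, Matrix.mul_assoc, ← Matrix.mul_assoc B.trBlock,
    B.trBlock_mul_cconj_cellPhase, Matrix.mul_assoc, ← Matrix.mul_assoc, ← B.cellPhase_add,
    gLine_sub, sub_eq_add_neg]

lemma IsBlochFrame.isSymmetricLoop {ψ : ℝ → Matrix B.Index (Fin 2) ℂ}
    (hψ : IsBlochFrame 𝓗 𝓑 j ψ) (hj : s j = -1) :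
    IsSymmetricLoop (periodicFrame B j ψ) (B.cellPhase (gLine j (2 * Real.pi)))
      (B.block 0 (pointOp s) * B.trBlock) B.trBlock where
  iso := hψ.iso
  unitary_V := B.isUnitaryMatrix_cellPhase _
  unitary_A := (B.isUnitaryMatrix_block _ _).mul B.isUnitaryMatrix_trBlock
  unitary_Θ := B.isUnitaryMatrix_trBlock
  antisymm := B.trBlock_transpose
  commute_A := by
    have e := B.cellPhase_mul_block (-gLine j (2 * Real.pi)) (h := pointOp s) rfl
    rw [rot_neg, rot_pointOp_gLine hj, neg_neg] at e
    have e2 : B.block (-gLine j (2 * Real.pi)) (pointOp s) = B.block 0 (pointOp s) := by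
      have := momentumEquiv_add_gLine j (-gLine j (2 * Real.pi))
      rw [neg_add_cancel] at this
      exact (B.block_eq_of_momentumEquiv this _).symm
    rw [Matrix.mul_assoc, Matrix.mul_assoc, B.trBlock_mul_cconj_cellPhase,
      ← Matrix.mul_assoc (B.block _ _), ← e, e2, Matrix.mul_assoc, ← Matrix.mul_assoc,
      (B.isUnitaryMatrix_cellPhase _).1, Matrix.one_mul]
  commute_Θ := by
    rw [Matrix.mul_assoc, B.trBlock_mul_cconj_cellPhase, ← Matrix.mul_assoc, ← B.cellPhase_add,
      add_neg_cancel, B.cellPhase_zero, Matrix.one_mul]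
  invariant_A := by
    intro t ht
    have h1 := 𝓗.range_block_mul_le
      (𝓗.range_trBlock_mul_cconj_le (hψ.2.1 t ht).2.le) (pointOp s)
    rw [rot_neg, rot_pointOp_gLine hj, neg_neg, ← (hψ.2.1 t ht).2] at h1
    obtain ⟨a, ha⟩ := exists_mul_of_range_le h1
    exact ⟨a, by rw [block_mul_trBlock_mul_cconj_periodicFrame hj, ha, periodicFrame,
      Matrix.mul_assoc]⟩
  invariant_Θ := by
    intro t ht
    have ht' : 2 * Real.pi - t ∈ Icc 0 (2 * Real.pi) := ⟨by linarith [ht.2], by linarith [ht.1]⟩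
    have h1 := 𝓗.range_trBlock_mul_cconj_le (hψ.2.1 t ht).2.le
    have h2 := momentumEquiv_add_gLine j (-gLine j t)
    rw [neg_add_eq_sub, ← gLine_sub] at h2
    rw [← 𝓗.bandSpace_eq_of_momentumEquiv h2, ← (hψ.2.1 _ ht').2] at h1
    obtain ⟨b, hb⟩ := exists_mul_of_range_le h1
    exact ⟨b, by rw [cellPhase_mul_trBlock_mul_cconj_periodicFrame, hb, periodicFrame,
      Matrix.mul_assoc]⟩
  closed := by
    rw [periodicFrame, periodicFrame, hψ.2.2, gLine_zero, B.cellPhase_zero, Matrix.one_mul]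

lemma IsBlochFrame.wilsonLoopEq_of {ψ : ℝ → Matrix B.Index (Fin N) ℂ}
    (hψ : IsBlochFrame 𝓗 𝓑 j ψ) {W : Matrix (Fin N) (Fin N) ℂ}
    (hW : IsPathOrderedExp (berryConnection B j ψ) W) : WilsonLoopEq B j ψ W := by
  intro W'
  refine ⟨fun hW' => ?_, fun h => h ▸ hW⟩
  rw [berryConnection_eq] at hW hW'
  exact hW.unique hψ.hasMatDeriv hψ.iso hW'

lemma IsBlochFrame.exists_wilsonLoop {ψ : ℝ → Matrix B.Index (Fin N) ℂ}
    (hψ : IsBlochFrame 𝓗 𝓑 j ψ) :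
    ∃ W v v', WilsonLoopEq B j ψ W ∧ IsParallelFrame (periodicFrame B j ψ) v v' (2 * Real.pi) ∧
      v 0 = periodicFrame B j ψ 0 ∧
      v (2 * Real.pi) = periodicFrame B j ψ (2 * Real.pi) * W := by
  obtain ⟨W, hW⟩ := exists_isPathOrderedExp hψ.hasMatDeriv hψ.continuousOn_deriv
  obtain ⟨v, v', hv, h0, h1⟩ := hW.exists_parallel hψ.hasMatDeriv hψ.iso
  rw [← berryConnection_eq] at hW
  exact ⟨W, v, v', hψ.wilsonLoopEq_of hW, hv, h0, h1⟩

theorem IsBlochFrame.wilsonLoopEq_one_or_neg_one {ψ : ℝ → Matrix B.Index (Fin 2) ℂ}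
    (hψ : IsBlochFrame 𝓗 𝓑 j ψ) (hj : s j = -1) :
    WilsonLoopEq B j ψ 1 ∨ WilsonLoopEq B j ψ (-1) := by
  obtain ⟨W, v, v', hW, hv, h0, h1⟩ := hψ.exists_wilsonLoop
  rcases (hψ.isSymmetricLoop hj).wilson_eq_one_or_neg_one hv h0 h1 with rfl | rfl
  · exact .inl hW
  · exact .inr hW

end Line

/-! ### Band representations induced from symmetric sites -/

section Induced

variable {s : Fin 3 → ℤˣ} {q : Fin 3 → ℝ} {m : Fin 3 → ℤ}

/-- The site-symmetry group of a symmetric site contains an element with every point operation. -/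
lemma IsSymmetricSite.exists_transl_mul (hq : IsSymmetricSite s q m) (h : DoubleSpaceGroup s) :
    ∃ t : Fin 3 → ℤ, ∃ g ∈ siteGroup s q, h = transl t * g := by
  refine ⟨h.tr - (hq.gen ^ h.pt.val : siteGroup s q).1.tr, _, (hq.gen ^ h.pt.val).2, ?_⟩
  ext i
  · change h.pt = 0 + _
    rw [hq.gen_pow_pt]
    simp
  · change h.tr i = (h.tr i - _) + sign s 0 i * _
    rw [sign_zero]
    ring

lemma BandRep.induced_block_apply (a : Shell s) (k : Fin 3 → ℝ) (h : DoubleSpaceGroup s)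
    (x y : Fin a.mult × Fin a.dim) :
    (BandRep.induced a).block k h ⟨(0 : Fin 1), x⟩ ⟨(0 : Fin 1), y⟩ = a.block k h x y :=
  Matrix.blockDiagonal'_apply_eq (fun _ : Fin 1 => a.block k h) 0 x y

lemma BandRep.induced_trBlock_apply (a : Shell s) (x y : Fin a.mult × Fin a.dim) :
    (BandRep.induced a).trBlock ⟨(0 : Fin 1), x⟩ ⟨(0 : Fin 1), y⟩ = a.trBlock x y :=
  Matrix.blockDiagonal'_apply_eq (fun _ : Fin 1 => a.trBlock) 0 x y

/-- The matrices of a band representation induced from an irreducible representation at a symmetric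
site `q`, in a suitable basis: one Kramers doublet per cell, with a phase that depends on `q`. -/
lemma Shell.IsIrrepAt.normal_form {a : Shell s} (ha : a.IsIrrepAt q) (hq : IsSymmetricSite s q m) :
    ∃ S : Matrix (Fin 2) (BandRep.induced a).Index ℂ, IsUnitaryMatrix S ∧
      (∀ k h, S * (BandRep.induced a).block k h =
        planeWave (rot h k) (act h q - q) • (kramersM ^ h.pt.val * S)) ∧
      S * (BandRep.induced a).trBlock = kramersΘ * cconj S := by
  obtain ⟨rfl, hirr⟩ := ha
  obtain ⟨S₀, hS₀, hρ, hΘ⟩ := equivalent_kramersDoublet hq a.rep hirr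
  obtain ⟨α₀, hα₀⟩ := a.exists_one
  have hα : ∀ α, α = α₀ := by
    intro α
    obtain ⟨t, g, hg, e⟩ := hq.exists_transl_mul (a.cosetRep α)
    refine (a.cosets (a.cosetRep α)).unique ⟨0, 1, one_mem _, ?_⟩ ⟨t, g, hg, ?_⟩
    · have : (transl 0 : DoubleSpaceGroup s) = 1 := rfl
      rw [this, one_mul, mul_one]
    · rw [hα₀, mul_one, e]
  let e : (BandRep.induced a).Index ≃ Fin a.dim :=
    { toFun := fun x => x.2.2
      invFun := fun l => ⟨(0 : Fin 1), α₀, l⟩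
      left_inv := by
        rintro ⟨c, α, l⟩
        obtain rfl : c = (0 : Fin 1) := Subsingleton.elim (α := Fin 1) _ _
        obtain rfl := hα α
        rfl
      right_inv := fun _ => rfl }
  have hpos : a.pos α₀ = a.site := by rw [Shell.pos, hα₀, act_one]
  have hblock : ∀ k h, ∃ g : siteGroup s a.site, (g : DoubleSpaceGroup s).pt = h.pt ∧
      (BandRep.induced a).block k h =
        (planeWave (rot h k) (act h a.site - a.site) • a.rep.ρ g).submatrix e e := by
    intro k h
    obtain ⟨t, g, hg, eh⟩ := hq.exists_transl_mul h
    have hpt : g.pt = h.pt := by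
      rw [eh]
      change g.pt = 0 + g.pt
      rw [zero_add]
    have hact : act h a.site = a.site + fun i => (t i : ℝ) := by
      have hg' : act g a.site = a.site := hg
      rw [eh, act_mul, hg', Shell.act_transl]
    have ht : a.shift h α₀ α₀ = t := Shell.shift_eq (by rw [hpos, hact])
    have htr : a.transfer h α₀ α₀ = g := by
      rw [Shell.transfer, ht, hα₀, eh, Shell.transl_neg]
      group
    refine ⟨⟨g, hg⟩, hpt, ?_⟩
    ext ⟨c, α, l⟩ ⟨c', α', l'⟩
    obtain rfl : c = (0 : Fin 1) := Subsingleton.elim (α := Fin 1) _ _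
    obtain rfl : c' = (0 : Fin 1) := Subsingleton.elim (α := Fin 1) _ _
    obtain rfl := hα α
    obtain rfl := hα α'
    refine (BandRep.induced_block_apply a k h (α', l) (α', l')).trans ?_
    rw [Shell.block_apply]
    simp only
    rw [ht, htr, KramersRep.extend, dif_pos hg, hact, add_sub_cancel_left]
    rfl
  have htr : (BandRep.induced a).trBlock = a.rep.Θ.submatrix e e := by
    ext ⟨c, α, l⟩ ⟨c', α', l'⟩
    obtain rfl : c = (0 : Fin 1) := Subsingleton.elim (α := Fin 1) _ _
    obtain rfl : c' = (0 : Fin 1) := Subsingleton.elim (α := Fin 1) _ _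
    obtain rfl := hα α
    obtain rfl := hα α'
    exact (BandRep.induced_trBlock_apply a (α', l) (α', l')).trans (if_pos rfl)
  refine ⟨S₀.submatrix id e, ⟨?_, ?_⟩, fun k h => ?_, ?_⟩
  · rw [conjTranspose_submatrix, ← Matrix.submatrix_mul _ _ e id e Function.bijective_id, hS₀.1,
      Matrix.submatrix_one_equiv]
  · rw [conjTranspose_submatrix, ← Matrix.submatrix_mul _ _ id e id e.bijective, hS₀.2,
      Matrix.submatrix_id_id]
  · obtain ⟨g, hg, hb⟩ := hblock k h
    rw [hb, ← Matrix.submatrix_mul _ _ id e e e.bijective, Matrix.mul_smul, hρ, kramersDoublet_ρ,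
      hg]
    rfl
  · rw [htr, ← Matrix.submatrix_mul _ _ id e e e.bijective, hΘ]
    rfl

/-- The shell of one Kramers doublet at a symmetric site. -/
noncomputable def kramersShell (hq : IsSymmetricSite s q m) : Shell s where
  site := q
  dim := 2
  rep := kramersDoublet s q
  mult := 1
  cosetRep := 1
  exists_one := ⟨0, rfl⟩
  cosets h := by
    obtain ⟨t, g, hg, e⟩ := hq.exists_transl_mul h
    exact ⟨0, ⟨t, g, hg, by simpa using! e⟩, fun _ _ => Subsingleton.elim _ _⟩

lemma exists_shell_isIrrepAt (hq : IsSymmetricSite s q m) : ∃ a : Shell s, a.IsIrrepAt q :=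
  ⟨kramersShell hq, rfl, kramersDoublet_isIrreducible hq⟩

/-- Kramers degeneracy: the number of orbitals is even. -/
lemma BandRep.even_card_index (B : BandRep s) : Even (Fintype.card B.Index) := by
  by_contra h
  have h1 := congrArg Matrix.det B.trBlock_transpose
  rw [Matrix.det_transpose, Matrix.det_neg, (Nat.not_even_iff_odd.1 h).neg_one_pow, neg_one_mul,
    self_eq_neg] at h1
  have h2 := B.isUnitaryMatrix_trBlock.conj_det_mul_det
  rw [h1] at h2
  simp at h2

lemma BandRep.card_index_sum (B C : BandRep s) :
    Fintype.card (B.sum C).Index = Fintype.card B.Index + Fintype.card C.Index := by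
  have h : ∀ D : BandRep s, Fintype.card D.Index
      = ∑ c : Fin D.num, (D.shell c).mult * (D.shell c).dim := fun D => by
    rw [Fintype.card_sigma]
    simp
  rw [h, h, h]
  refine (Fin.sum_univ_add (a := B.num) (b := C.num) fun c : Fin (B.num + C.num) =>
    (Fin.append B.shell C.shell c).mult * (Fin.append B.shell C.shell c).dim).trans ?_
  simp

lemma Shell.IsIrrepAt.isElementary {a : Shell s} (ha : a.IsIrrepAt q)
    (hq : IsSymmetricSite s q m) : (BandRep.induced a).IsElementary := by
  obtain ⟨S, hS, -, -⟩ := ha.normal_form hq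
  have hcard : Fintype.card (BandRep.induced a).Index = 2 := by rw [← hS.card_eq, Fintype.card_fin]
  refine ⟨Fintype.card_pos_iff.1 (by rw [hcard]; norm_num), ?_⟩
  rintro C D hC hD ⟨U, -, hU, -⟩
  have h := (hU 0).card_eq
  rw [BandRep.card_index_sum, hcard] at h
  have := Fintype.card_pos_iff.2 hC
  have := Fintype.card_pos_iff.2 hD
  obtain ⟨c, hc⟩ := C.even_card_index
  obtain ⟨d, hd⟩ := D.even_card_index
  omega

/-- The even elements `E`, `Ē` of the double point group act as scalars, the odd ones as multiples
of the generator. -/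
lemma pt_cases (n : ZMod 4) :
    (∃ ε : ℂ, kramersM ^ n.val = ε • (1 : Matrix (Fin 2) (Fin 2) ℂ) ∧ ∀ i, sign s n i = 1) ∨
      ∃ ε : ℂ, kramersM ^ n.val = ε • kramersM ∧ ∀ i, sign s n i = (s i : ℤ) := by
  rcases zmod_four_cases n with rfl | rfl | rfl | rfl
  · exact .inl ⟨1, by simp, sign_zero⟩
  · exact .inr ⟨1, by rw [show (1 : ZMod 4).val = 1 from rfl]; simp, sign_pt_one⟩
  · exact .inl ⟨-1, by rw [show (2 : ZMod 4).val = 2 from rfl, kramersM_sq]; simp, sign_pt_two⟩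
  · refine .inr ⟨-1, ?_, sign_pt_three⟩
    rw [show (3 : ZMod 4).val = 2 + 1 from rfl, pow_succ, kramersM_sq]
    simp

lemma act_sub_self_of_even {h : DoubleSpaceGroup s} (hs : ∀ i, sign s h.pt i = 1) :
    act h q - q = fun i => (h.tr i : ℝ) := by
  ext i; simp [act, hs]

lemma rot_of_even {h : DoubleSpaceGroup s} (hs : ∀ i, sign s h.pt i = 1) (k : Fin 3 → ℝ) :
    rot h k = k := by
  ext i; simp [rot, hs]

lemma rot_of_odd {h : DoubleSpaceGroup s} (hs : ∀ i, sign s h.pt i = (s i : ℤ))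
    (k : Fin 3 → ℝ) : rot h k = rot (pointOp s) k := by
  ext i
  change (sign s h.pt i : ℝ) * k i = (sign s 1 i : ℝ) * k i
  rw [hs, sign_pt_one]

lemma IsSymmetricSite.smul_eq (hq : IsSymmetricSite s q m) (i : Fin 3) :
    ((s i : ℤ) : ℝ) * m i = -m i := by
  have h := hq i
  rcases Int.units_eq_one_or (s i) with hs | hs
  · rw [hs] at h ⊢
    simp only [Units.val_one, Int.cast_one, one_mul, sub_self] at h ⊢
    rw [← h]; simp
  · rw [hs]; simp

lemma IsSymmetricSite.planeWave_rot (hq : IsSymmetricSite s q m) (k : Fin 3 → ℝ) :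
    planeWave (rot (pointOp s) k) (fun i => (m i : ℝ)) = planeWave (-k) fun i => (m i : ℝ) := by
  rw [planeWave, planeWave]
  congr 3
  refine Finset.sum_congr rfl fun i _ => ?_
  change ((sign s 1 i : ℤ) : ℝ) * k i * m i = -k i * m i
  rw [sign_pt_one]
  linear_combination k i * hq.smul_eq i

/-- The dependence on the site of the phase of an odd element. -/
lemma IsSymmetricSite.planeWave_of_odd (hq : IsSymmetricSite s q m) {h : DoubleSpaceGroup s}
    (hs : ∀ i, sign s h.pt i = (s i : ℤ)) (k : Fin 3 → ℝ) :
    planeWave (rot h k) (act h q - q) =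
      planeWave (rot h k) (fun i => (h.tr i : ℝ)) * planeWave k fun i => (m i : ℝ) := by
  have e : act h q - q = (fun i => (h.tr i : ℝ)) + -fun i => (m i : ℝ) := by
    ext i
    have := hq i
    simp only [act, hs, Pi.sub_apply, Pi.add_apply, Pi.neg_apply]
    linarith
  rw [e, planeWave_add_right, planeWave_neg_right, ← rot_neg, rot_of_odd hs (-k),
    hq.planeWave_rot, neg_neg]

variable {q' : Fin 3 → ℝ} {m' : Fin 3 → ℤ} {a a' : Shell s}

lemma trace_of_unitary {n : Type*} [Fintype n] [DecidableEq n] {S : Matrix (Fin 2) n ℂ}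
    (hS : IsUnitaryMatrix S) {M : Matrix n n ℂ} {N : Matrix (Fin 2) (Fin 2) ℂ}
    (h : S * M = N * S) : M.trace = N.trace := by
  rw [← Matrix.one_mul M, ← hS.1, Matrix.mul_assoc, h, Matrix.trace_mul_comm, Matrix.mul_assoc,
    hS.2, Matrix.mul_one]

lemma Shell.IsIrrepAt.irrepEquivalent (ha : a.IsIrrepAt q) (hq : IsSymmetricSite s q m)
    (ha' : a'.IsIrrepAt q') (hq' : IsSymmetricSite s q' m') :
    (BandRep.induced a).IrrepEquivalent (BandRep.induced a') := by
  obtain ⟨S, hS, hb, -⟩ := ha.normal_form hq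
  obtain ⟨S', hS', hb', -⟩ := ha'.normal_form hq'
  intro k h _
  have e := hb k h
  have e' := hb' k h
  rw [← Matrix.smul_mul] at e e'
  rw [trace_of_unitary hS e, trace_of_unitary hS' e', Matrix.trace_smul, Matrix.trace_smul]
  rcases pt_cases (s := s) h.pt with ⟨ε, hε, hs⟩ | ⟨ε, hε, hs⟩
  · rw [act_sub_self_of_even hs, act_sub_self_of_even hs]
  · rw [hε, Matrix.trace_smul, trace_kramersM]
    simp

/-- A `2 × 2` matrix that intertwines the actions of the little group on the two doublets. The
two signs of the odd elements at a momentum fixed by the point operation can differ; then time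
reversal of the doublet exchanges the eigenvalues. Elsewhere, the phases are removed by a scalar. -/
lemma exists_little_group_intertwiner (hq : IsSymmetricSite s q m) (hq' : IsSymmetricSite s q' m')
    (k : Fin 3 → ℝ) : ∃ X : Matrix (Fin 2) (Fin 2) ℂ, IsUnitaryMatrix X ∧
      (MomentumEquiv k (rot (pointOp s) k) →
        planeWave k (fun i => (m i : ℝ)) • (X * kramersM) =
          planeWave k (fun i => (m' i : ℝ)) • (kramersM * X)) ∧
      (MomentumEquiv k (-k) → X * kramersΘ = kramersΘ * cconj X) ∧
      planeWave (-k) (fun i => (m i : ℝ)) • (X * (kramersM * kramersΘ)) =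
        planeWave (-k) (fun i => (m' i : ℝ)) • (kramersM * kramersΘ * cconj X) := by
  by_cases hk : MomentumEquiv k (rot (pointOp s) k)
  · have neg : ∀ {q m}, IsSymmetricSite s q m →
        planeWave (-k) (fun i => (m i : ℝ)) = planeWave k fun i => (m i : ℝ) := fun hq => by
      rw [← hq.planeWave_rot, hk.planeWave_eq]
    have sq : ∀ {q m}, IsSymmetricSite s q m →
        planeWave k (fun i => (m i : ℝ)) = 1 ∨ planeWave k (fun i => (m i : ℝ)) = -1 := fun hq => by
      rw [← mul_self_eq_one_iff]
      nth_rewrite 1 [← neg hq]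
      exact planeWave_neg_mul
    rw [neg hq, neg hq']
    by_cases heq : planeWave k (fun i => (m i : ℝ)) = planeWave k fun i => (m' i : ℝ)
    · rw [heq]
      exact ⟨1, isUnitaryMatrix_one, by simp, by simp, by simp⟩
    · have hopp : planeWave k (fun i => (m i : ℝ)) = -planeWave k fun i => (m' i : ℝ) := by
        rcases sq hq with h | h <;> rcases sq hq' with h' | h' <;> rw [h, h'] at heq ⊢ <;>
          simp at heq ⊢
      refine ⟨kramersΘ, isUnitaryMatrix_kramersΘ, fun _ => ?_, fun _ => ?_, ?_⟩
      · rw [hopp, kramersΘ_mul_kramersM, neg_smul, smul_neg, neg_neg]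
      · rw [cconj_kramersΘ]
      · rw [hopp, ← Matrix.mul_assoc, kramersΘ_mul_kramersM, cconj_kramersΘ, neg_smul,
          Matrix.neg_mul, smul_neg, neg_neg]
  · have hk2 : ¬ MomentumEquiv k (-k) := by
      rintro ⟨n, hn⟩
      refine hk ⟨fun i => if s i = 1 then 0 else n i, fun i => ?_⟩
      have := hn i
      change (sign s 1 i : ℝ) * k i = _
      rw [sign_pt_one]
      rcases Int.units_eq_one_or (s i) with hs | hs
      · simp [hs]
      · have h1 : s i ≠ 1 := by rw [hs]; decide
        simpa [hs, h1] using! this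
    let c : ℂ := planeWave (-k) ((1 / 2 : ℝ) • ((fun i => (m' i : ℝ)) - fun i => (m i : ℝ)))
    have hc : conj c * c = 1 := conj_planeWave_mul
    have hcc : planeWave (-k) (fun i => (m i : ℝ)) * c =
        planeWave (-k) (fun i => (m' i : ℝ)) * conj c := by
      simp only [c]
      rw [conj_planeWave, ← planeWave_neg_right (k := -k), ← planeWave_add_right,
        ← planeWave_add_right]
      congr 1
      ext i
      simp
      ring
    refine ⟨c • 1, isUnitaryMatrix_one.smul hc, fun h => (hk h).elim, fun h => (hk2 h).elim, ?_⟩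
    rw [cconj_smul, cconj_one, Matrix.smul_mul, Matrix.mul_smul, Matrix.one_mul, Matrix.mul_one,
      smul_smul, smul_smul, hcc]

lemma Shell.IsIrrepAt.littleGroupEquivalent (ha : a.IsIrrepAt q) (hq : IsSymmetricSite s q m)
    (ha' : a'.IsIrrepAt q') (hq' : IsSymmetricSite s q' m') :
    (BandRep.induced a).LittleGroupEquivalent (BandRep.induced a') := by
  obtain ⟨S, hS, hb, ht⟩ := ha.normal_form hq
  obtain ⟨S', hS', hb', ht'⟩ := ha'.normal_form hq'
  intro k
  obtain ⟨X, hX, h1, h2, h3⟩ := exists_little_group_intertwiner hq hq' k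
  have transport : ∀ {M : Matrix (BandRep.induced a).Index (BandRep.induced a).Index ℂ}
      {N Q : Matrix (Fin 2) (Fin 2) ℂ}
      {P : Matrix (BandRep.induced a').Index (BandRep.induced a').Index ℂ},
      S * M = N * S → S' * P = Q * S' → X * N = Q * X →
      S'ᴴ * X * S * M = P * (S'ᴴ * X * S) := by
    intro M N Q P e e' e''
    have e3 : P * S'ᴴ = S'ᴴ * Q := by
      rw [← Matrix.one_mul (P * _), ← hS'.1, Matrix.mul_assoc, ← Matrix.mul_assoc S', e',
        Matrix.mul_assoc, hS'.2, Matrix.mul_one]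
    calc S'ᴴ * X * S * M = S'ᴴ * (X * N) * S := by simp only [Matrix.mul_assoc, e]
      _ = P * (S'ᴴ * X * S) := by rw [e'']; simp only [← Matrix.mul_assoc, e3]
  have transport_anti : ∀ {M : Matrix (BandRep.induced a).Index (BandRep.induced a).Index ℂ}
      {N Q : Matrix (Fin 2) (Fin 2) ℂ}
      {P : Matrix (BandRep.induced a').Index (BandRep.induced a').Index ℂ},
      S * M = N * cconj S → S' * P = Q * cconj S' →
      X * N = Q * cconj X → S'ᴴ * X * S * M = P * cconj (S'ᴴ * X * S) := by
    intro M N Q P e e' e''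
    have e3 : P * cconj S'ᴴ = S'ᴴ * Q := by
      rw [← Matrix.one_mul (P * _), ← hS'.1, Matrix.mul_assoc, ← Matrix.mul_assoc S', e',
        Matrix.mul_assoc, ← cconj_mul, hS'.2, cconj_one, Matrix.mul_one]
    calc S'ᴴ * X * S * M = S'ᴴ * (X * N) * cconj S := by simp only [Matrix.mul_assoc, e]
      _ = P * cconj (S'ᴴ * X * S) := by
        rw [e'', cconj_mul, cconj_mul]; simp only [← Matrix.mul_assoc, e3]
  have anti : ∀ {a : Shell s} {q} {S : Matrix (Fin 2) (BandRep.induced a).Index ℂ},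
      (∀ k h, S * (BandRep.induced a).block k h =
        planeWave (rot h k) (act h q - q) • (kramersM ^ h.pt.val * S)) →
      S * (BandRep.induced a).trBlock = kramersΘ * cconj S → ∀ k h,
      S * ((BandRep.induced a).block k h * (BandRep.induced a).trBlock) =
        planeWave (rot h k) (act h q - q) • (kramersM ^ h.pt.val * kramersΘ) * cconj S := by
    intro a q S hb ht k h
    rw [← Matrix.mul_assoc, hb, Matrix.smul_mul, Matrix.mul_assoc, ht, Matrix.smul_mul,
      Matrix.mul_assoc]
  refine ⟨S'ᴴ * X * S, (hS'.conjTranspose.mul hX).mul hS, fun h hk => ?_, fun h hk => ?_⟩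
  · refine transport ((hb k h).trans (Matrix.smul_mul _ _ _).symm)
      ((hb' k h).trans (Matrix.smul_mul _ _ _).symm) ?_
    rcases pt_cases (s := s) h.pt with ⟨ε, hε, hs⟩ | ⟨ε, hε, hs⟩
    · simp [act_sub_self_of_even hs, hε]
    · rw [rot_of_odd hs] at hk
      have := h1 hk
      rw [hε, hq.planeWave_of_odd hs, hq'.planeWave_of_odd hs, mul_smul, mul_smul, Matrix.mul_smul,
        Matrix.mul_smul, Matrix.mul_smul, Matrix.smul_mul, Matrix.smul_mul, Matrix.smul_mul,
        smul_comm _ ε, this]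
      module
  · refine transport_anti (anti hb ht (-k) h) (anti hb' ht' (-k) h) ?_
    rcases pt_cases (s := s) h.pt with ⟨ε, hε, hs⟩ | ⟨ε, hε, hs⟩
    · rw [rot_of_even hs] at hk
      simp [act_sub_self_of_even hs, hε, h2 hk]
    · rw [hε, hq.planeWave_of_odd hs, hq'.planeWave_of_odd hs, mul_smul, mul_smul, Matrix.mul_smul,
        Matrix.mul_smul, Matrix.smul_mul, Matrix.mul_smul, Matrix.smul_mul, Matrix.smul_mul,
        Matrix.smul_mul, smul_comm _ ε, h3]
      module

end Induced

section Inequivalent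

variable {s : Fin 3 → ℤˣ} {q q' : Fin 3 → ℝ} {m m' : Fin 3 → ℤ} {a a' : Shell s} {j : Fin 3}

/-- The phase of the point operation, which maps `-k` to `k` on the line. -/
lemma planeWave_pointOp_neg (hj : s j = -1) (q : Fin 3 → ℝ) (t : ℝ) :
    planeWave (gLine j t) (act (pointOp s) q - q) = Complex.exp (2 * Complex.I * t * q j) := by
  rw [planeWave_gLine]
  congr 1
  have : (act (pointOp s) q - q) j = -2 * q j := by
    change ((sign s 1 j : ℤ) : ℝ) * q j + ((0 : ℤ) : ℝ) - q j = _
    rw [sign_pt_one, hj]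
    simp
    ring
  rw [this]
  push_cast
  ring

lemma pointOp_pt_val : (pointOp s).pt.val = 1 := rfl

/-- A gauge transformation between the two band representations would have a determinant which is
`1` at the time-reversal invariant momenta `0` and `π`, but has the phase
`exp (2 i t (q'ⱼ - qⱼ))` along the line. -/
lemma Shell.IsIrrepAt.exp_eq_of_gaugeEquivalent (ha : a.IsIrrepAt q) (hq : IsSymmetricSite s q m)
    (ha' : a'.IsIrrepAt q') (hq' : IsSymmetricSite s q' m') (hj : s j = -1)
    (h : (BandRep.induced a).GaugeEquivalent (BandRep.induced a')) :
    Complex.exp (2 * Complex.I * Real.pi * q j) = Complex.exp (2 * Complex.I * Real.pi * q' j) := by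
  obtain ⟨S, hS, hb, ht⟩ := ha.normal_form hq
  obtain ⟨S', hS', hb', ht'⟩ := ha'.normal_form hq'
  obtain ⟨U, hUc, hU, hUp, hUb, hUt⟩ := h
  set X : (Fin 3 → ℝ) → Matrix (Fin 2) (Fin 2) ℂ := fun k => S' * U k * Sᴴ with hX
  have hXu : ∀ k, IsUnitaryMatrix (X k) := fun k => (hS'.mul (hU k)).mul hS.conjTranspose
  have hXt : ∀ k, kramersΘ * cconj (X k) = X (-k) * kramersΘ := by
    intro k
    have e1 : cconj S * cconj Sᴴ = 1 := by rw [← cconj_mul, hS.2, cconj_one]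
    calc kramersΘ * cconj (X k) = kramersΘ * cconj S' * cconj (U k) * cconj Sᴴ := by
          rw [hX, cconj_mul, cconj_mul]; simp only [Matrix.mul_assoc]
      _ = S' * ((BandRep.induced a').trBlock * cconj (U k)) * cconj Sᴴ := by
          rw [← ht']; simp only [Matrix.mul_assoc]
      _ = S' * U (-k) * (Sᴴ * (S * (BandRep.induced a).trBlock)) * cconj Sᴴ := by
          rw [hUt, ← Matrix.mul_assoc Sᴴ, hS.1, Matrix.one_mul]; simp only [Matrix.mul_assoc]
      _ = X (-k) * kramersΘ := by
          rw [ht]; simp only [hX, Matrix.mul_assoc, e1, Matrix.mul_one]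
  have hXb : ∀ k, planeWave (rot (pointOp s) k) (act (pointOp s) q' - q') • (kramersM * X k) =
      planeWave (rot (pointOp s) k) (act (pointOp s) q - q) •
        (X (rot (pointOp s) k) * kramersM) := by
    intro k
    have e := hb k (pointOp s)
    have e' := hb' k (pointOp s)
    rw [pointOp_pt_val, pow_one] at e e'
    calc planeWave (rot (pointOp s) k) (act (pointOp s) q' - q') • (kramersM * X k)
        = planeWave (rot (pointOp s) k) (act (pointOp s) q' - q') • (kramersM * S') *
            (U k * Sᴴ) := by
          rw [hX, Matrix.smul_mul]; simp only [Matrix.mul_assoc]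
      _ = S' * ((BandRep.induced a').block k (pointOp s) * U k) * Sᴴ := by
          rw [← e']; simp only [Matrix.mul_assoc]
      _ = S' * U (rot (pointOp s) k) *
            (Sᴴ * (S * (BandRep.induced a).block k (pointOp s))) * Sᴴ := by
          rw [hUb, ← Matrix.mul_assoc Sᴴ, hS.1, Matrix.one_mul]; simp only [Matrix.mul_assoc]
      _ = _ := by
          rw [e]
          simp only [hX, Matrix.mul_smul, Matrix.smul_mul, Matrix.mul_assoc, hS.2, Matrix.mul_one]
  have hXc : Continuous fun k => (X k).det := by
    have h1 : ∀ x y, Continuous fun k => X k x y := by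
      intro x y
      simp only [hX, Matrix.mul_apply]
      fun_prop
    simp only [Matrix.det_fin_two]
    fun_prop
  -- at the time-reversal invariant momenta, the transformation is in `SU(2)`
  have hdet1 : ∀ k, MomentumEquiv k (-k) → (X k).det = 1 := by
    intro k hk
    have hp : X (-k) = X k := by simp only [hX, hUp k (-k) hk]
    have h1 := hXt k
    rw [hp] at h1
    have h2 := conjTranspose_mul_mul_cconj_of_antisymm kramersΘ_transpose (X k)
    rw [Matrix.mul_assoc, h1, ← Matrix.mul_assoc, (hXu k).1, Matrix.one_mul] at h2
    have h3 : (1 - conj (X k).det) • kramersΘ = 0 := by rw [sub_smul, ← h2, one_smul, sub_self]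
    rw [smul_eq_zero, or_iff_left kramersΘ_ne_zero, sub_eq_zero] at h3
    simpa using! congrArg conj h3.symm
  set d : ℝ → ℂ := fun t => (X (gLine j t)).det with hd
  have hdc : Continuous d := by
    refine hXc.comp ?_
    exact continuous_pi fun i => by
      by_cases hi : i = j
      · subst hi; simpa [gLine] using! continuous_id
      · simpa [gLine, hi] using! continuous_const
  have hd0 : d 0 = 1 := hdet1 _ ⟨0, fun i => by simp⟩
  have hdpi : d Real.pi = 1 := by
    refine hdet1 _ ?_
    have := momentumEquiv_add_gLine j (-gLine j Real.pi)
    rw [neg_add_eq_sub, ← gLine_sub] at this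
    obtain ⟨n, hn⟩ := this
    refine ⟨-n, fun i => ?_⟩
    have := hn i
    rw [show 2 * Real.pi - Real.pi = Real.pi by ring] at this
    simp only [Pi.neg_apply] at this ⊢
    push_cast
    linarith
  have hsq : ∀ t ∈ Icc 0 Real.pi,
      d t ^ 2 = Complex.exp (2 * Complex.I * t * (q' j - q j)) ^ 2 := by
    intro t _
    have h1 := congrArg Matrix.det (hXb (-gLine j t))
    rw [rot_neg, rot_pointOp_gLine hj, neg_neg, planeWave_pointOp_neg hj,
      planeWave_pointOp_neg hj, Matrix.det_smul, Matrix.det_smul, Matrix.det_mul, Matrix.det_mul,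
      det_kramersM, one_mul, mul_one, Fintype.card_fin] at h1
    have h2 := congrArg Matrix.det (hXt (gLine j t))
    rw [Matrix.det_mul, Matrix.det_mul, det_kramersΘ, one_mul, mul_one, det_cconj] at h2
    rw [← h2] at h1
    have h3 := (hXu (gLine j t)).conj_det_mul_det
    have e : Complex.exp (2 * Complex.I * t * (q' j - q j)) *
        Complex.exp (2 * Complex.I * t * q j) =
        Complex.exp (2 * Complex.I * t * q' j) := by
      rw [← Complex.exp_add]
      congr 1
      ring
    rw [← e] at h1
    have h4 := Complex.exp_ne_zero (2 * Complex.I * t * q j)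
    generalize Complex.exp (2 * Complex.I * t * (q' j - q j)) = x at h1 ⊢
    generalize Complex.exp (2 * Complex.I * t * q j) = y at h1 h4
    have h5 : x ^ 2 * conj (X (gLine j t)).det = (X (gLine j t)).det := by
      refine mul_left_cancel₀ (pow_ne_zero 2 h4) ?_
      rw [← h1]; ring
    change (X (gLine j t)).det ^ 2 = x ^ 2
    linear_combination -(X (gLine j t)).det * h5 + x ^ 2 * h3
  have m0 : (0 : ℝ) ∈ Icc 0 Real.pi := ⟨le_rfl, Real.pi_pos.le⟩
  have key : d Real.pi = Complex.exp (2 * Complex.I * Real.pi * (q' j - q j)) := by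
    rcases isPreconnected_Icc.eq_or_eq_neg_of_sq_eq hdc.continuousOn
      (g := fun t : ℝ => Complex.exp (2 * Complex.I * t * (q' j - q j)))
      (Continuous.continuousOn (by fun_prop)) hsq (fun {t} _ => Complex.exp_ne_zero _) with k | k
    · exact k ⟨Real.pi_pos.le, le_rfl⟩
    · have := k m0
      rw [hd0] at this
      simp at this
      norm_num [eq_neg_iff_add_eq_zero] at this
  rw [hdpi] at key
  have e : 2 * Complex.I * Real.pi * q' j =
      2 * Complex.I * Real.pi * (q' j - q j) + 2 * Complex.I * Real.pi * q j := by ring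
  rw [e, Complex.exp_add, ← key, one_mul]

end Inequivalent

/-! ### Bands that transform as an induced band representation -/

section Transforms

variable {s : Fin 3 → ℤˣ} {B : BandRep s}

lemma BlochHamiltonian.bandSpace_univ (𝓗 : BlochHamiltonian B) (k : Fin 3 → ℝ) :
    𝓗.bandSpace Finset.univ k = ⊤ := by
  refine (Submodule.eq_top_iff'.2 fun v => ?_)
  have h : v = ∑ i, (𝓗.hermitian k).eigenvectorBasis.repr (WithLp.toLp 2 v) i •
      (((𝓗.hermitian k).eigenvectorBasis i).ofLp) := by
    have := congrArg WithLp.ofLp ((𝓗.hermitian k).eigenvectorBasis.sum_repr (WithLp.toLp 2 v))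
    simpa using! this.symm
  rw [h]
  refine Submodule.sum_mem _ fun i _ => Submodule.smul_mem _ _ (Submodule.subset_span ?_)
  refine ⟨(Fintype.equivOfCardEq (Fintype.card_fin _)).symm i, Finset.mem_univ _, ?_⟩
  exact (𝓗.hermitian k).mulVec_eigenvectorBasis i

lemma BlochHamiltonian.transformsAs_univ (𝓗 : BlochHamiltonian B) :
    𝓗.TransformsAs Finset.univ B := by
  refine ⟨fun k b _ c hc => (hc (Finset.mem_univ c)).elim, fun _ => 1, fun x y => contDiff_const,
    fun _ _ _ => rfl, by simp, fun k => ?_, by simp, by simp⟩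
  rw [𝓗.bandSpace_univ, Matrix.mulVecLin_one, LinearMap.range_id]

variable {q : Fin 3 → ℝ} {m : Fin 3 → ℤ} {a : Shell s} {j : Fin 3}
  {𝓗 : BlochHamiltonian B} {𝓑 : Finset (Fin (Fintype.card B.Index))}

/-- Bands that transform as the representation induced from `q` have the Wilson loop
`exp (2 π i qⱼ)`: the columns of the matrix that intertwines the two representations are a global
frame in which `IsSymmetricLoop.wilson_eq_exp` applies. -/
theorem Shell.IsIrrepAt.wilsonLoopEq_exp (ha : a.IsIrrepAt q) (hq : IsSymmetricSite s q m)
    (hj : s j = -1) (hT : 𝓗.TransformsAs 𝓑 (BandRep.induced a)) :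
    (∃ ψ : ℝ → Matrix B.Index (Fin 2) ℂ, IsBlochFrame 𝓗 𝓑 j ψ) ∧
      ∀ ψ : ℝ → Matrix B.Index (Fin 2) ℂ, IsBlochFrame 𝓗 𝓑 j ψ →
        WilsonLoopEq B j ψ (Complex.exp (2 * Complex.I * Real.pi * q j) • 1) := by
  obtain ⟨S, hS, hb, ht⟩ := ha.normal_form hq
  obtain ⟨-, Φ, hΦc, hΦp, hΦ, hΦr, hΦb, hΦt⟩ := hT
  set χ : ℝ → Matrix B.Index (Fin 2) ℂ := fun t => Φ (gLine j t) * Sᴴ with hχ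
  have hSS : IsUnitaryMatrix Sᴴ := hS.conjTranspose
  have hperiod : ∀ t, Φ (gLine j (2 * Real.pi - t)) = Φ (-gLine j t) := by
    intro t
    have := momentumEquiv_add_gLine j (-gLine j t)
    rw [neg_add_eq_sub, ← gLine_sub] at this
    exact hΦp _ _ this
  have hrange : ∀ t, LinearMap.range (χ t).mulVecLin = 𝓗.bandSpace 𝓑 (gLine j t) := by
    intro t
    rw [← hΦr]
    apply le_antisymm
    · rintro _ ⟨x, rfl⟩
      exact ⟨Sᴴ *ᵥ x, by simp only [hχ, Matrix.mulVecLin_apply, Matrix.mulVec_mulVec]⟩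
    · rintro _ ⟨x, rfl⟩
      refine ⟨S *ᵥ x, ?_⟩
      simp only [hχ, Matrix.mulVecLin_apply, Matrix.mulVec_mulVec, Matrix.mul_assoc, hS.1,
        Matrix.mul_one]
  have hframe : IsBlochFrame 𝓗 𝓑 j χ := by
    refine ⟨fun x l => ?_, fun t _ => ⟨?_, hrange t⟩, ?_⟩
    · refine ContDiff.contDiffOn ?_
      simp only [hχ, Matrix.mul_apply]
      refine ContDiff.sum fun y _ => ContDiff.mul ((hΦc x y).comp ?_) contDiff_const
      exact contDiff_pi.2 fun i => by
        by_cases hi : i = j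
        · subst hi; simpa [gLine] using! contDiff_id
        · simpa [gLine, hi] using! contDiff_const
    · rw [hχ, conjTranspose_mul, Matrix.mul_assoc, ← Matrix.mul_assoc _ _ Sᴴ, hΦ, Matrix.one_mul,
        hSS.1]
    · have := hperiod 0
      simp only [sub_zero, gLine_zero, neg_zero] at this
      simp only [hχ, this, gLine_zero]
  refine ⟨⟨χ, hframe⟩, fun ψ hψ => ?_⟩
  have hχt : ∀ t, B.trBlock * cconj (χ t) = Φ (-gLine j t) * Sᴴ * kramersΘ := by
    intro t
    have e1 : cconj S * cconj Sᴴ = 1 := by rw [← cconj_mul, hS.2, cconj_one]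
    calc B.trBlock * cconj (χ t)
        = Φ (-gLine j t) * (Sᴴ * (S * (BandRep.induced a).trBlock)) * cconj Sᴴ := by
          rw [hχ, cconj_mul, ← Matrix.mul_assoc, hΦt, ← Matrix.mul_assoc Sᴴ, hS.1, Matrix.one_mul]
      _ = _ := by rw [ht]; simp only [Matrix.mul_assoc, e1, Matrix.mul_one]
  have hχb : ∀ t, B.block (-gLine j t) (pointOp s) * (Φ (-gLine j t) * Sᴴ) =
      Complex.exp (2 * Complex.I * t * q j) • (χ t * kramersM) := by
    intro t
    have e := hb (-gLine j t) (pointOp s)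
    rw [rot_neg, rot_pointOp_gLine hj, neg_neg, planeWave_pointOp_neg hj, pointOp_pt_val,
      pow_one] at e
    have e2 := hΦb (-gLine j t) (pointOp s)
    rw [rot_neg, rot_pointOp_gLine hj, neg_neg] at e2
    calc _ = Φ (gLine j t) * (Sᴴ * (S * (BandRep.induced a).block (-gLine j t) (pointOp s))) *
          Sᴴ := by
          rw [← Matrix.mul_assoc, e2, ← Matrix.mul_assoc Sᴴ, hS.1, Matrix.one_mul]
      _ = _ := by
          rw [e]
          simp only [hχ, Matrix.mul_smul, Matrix.smul_mul, Matrix.mul_assoc, hS.2, Matrix.mul_one]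
  obtain ⟨W, v, v', hW, hv, h0, h1⟩ := hψ.exists_wilsonLoop
  have hloop := hψ.isSymmetricLoop hj
  obtain ⟨c, rfl⟩ : ∃ c : ℂ, W = c • 1 := by
    rcases hloop.wilson_eq_one_or_neg_one hv h0 h1 with rfl | rfl
    · exact ⟨1, by simp⟩
    · exact ⟨-1, by simp⟩
  have hc := hloop.wilson_eq_exp hv h0 h1 (φ := periodicFrame B j χ) (K := kramersM * kramersΘ)
    (L := kramersΘ) (q := q j)
    (fun x l => (contDiffOn_periodicFrame hframe.1 x l).continuousOn) hframe.iso
    (fun t ht => by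
      obtain ⟨X, hX⟩ := exists_mul_of_range_le (X := χ t) (Y := ψ t)
        (by rw [hrange, (hψ.2.1 t ht).2])
      exact ⟨X, by rw [periodicFrame, hX, ← Matrix.mul_assoc]; rfl⟩)
    (by rw [periodicFrame, periodicFrame, hframe.2.2, gLine_zero, B.cellPhase_zero, Matrix.one_mul])
    (fun t _ => by
      rw [block_mul_trBlock_mul_cconj_periodicFrame hj, hχt, ← Matrix.mul_assoc (B.block _ _), hχb,
        periodicFrame]
      simp only [Matrix.mul_smul, Matrix.smul_mul, Matrix.mul_assoc])
    (fun t _ => by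
      rw [cellPhase_mul_trBlock_mul_cconj_periodicFrame, hχt, periodicFrame]
      simp only [hχ, hperiod, Matrix.mul_assoc])
    (by rw [Matrix.det_mul, det_kramersM, det_kramersΘ]; simp) kramersΘ_transpose kramersΘ_ne_zero
  rwa [← hc]

end Transforms

/-! ### The space groups `P112` and `P11m` -/

section Wyckoff

lemma exists_half_integer {x : ℝ} {m : ℤ} (h : 2 * x = m) :
    ∃ n : ℤ, x = n ∨ x = 1 / 2 + n := by
  obtain ⟨n, rfl | rfl⟩ := Int.even_or_odd' m
  · refine ⟨n, .inl ?_⟩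
    push_cast at h
    linarith
  · refine ⟨n, .inr ?_⟩
    push_cast at h
    linarith

lemma isSymmetricSite_P112_iff {q : Fin 3 → ℝ} : (∃ m, IsSymmetricSite P112 q m) ↔
    ∃ (w : WyckoffP112) (z : ℝ) (n : Fin 3 → ℤ), q = w.site z + fun i => (n i : ℝ) := by
  constructor
  · rintro ⟨m, hm⟩
    have h0 : 2 * q 0 = m 0 := by rw [← hm 0]; simp [P112]; ring
    have h1 : 2 * q 1 = m 1 := by rw [← hm 1]; simp [P112]; ring
    obtain ⟨n0, hn0⟩ := exists_half_integer h0
    obtain ⟨n1, hn1⟩ := exists_half_integer h1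
    rcases hn0 with hn0 | hn0 <;> rcases hn1 with hn1 | hn1
    · refine ⟨.a, q 2, ![n0, n1, 0], ?_⟩
      ext i; fin_cases i <;> simp [WyckoffP112.site, hn0, hn1]
    · refine ⟨.b, q 2, ![n0, n1, 0], ?_⟩
      ext i; fin_cases i <;> simp [WyckoffP112.site, hn0, hn1]
    · refine ⟨.c, q 2, ![n0, n1, 0], ?_⟩
      ext i; fin_cases i <;> simp [WyckoffP112.site, hn0, hn1]
    · refine ⟨.d, q 2, ![n0, n1, 0], ?_⟩
      ext i; fin_cases i <;> simp [WyckoffP112.site, hn0, hn1]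
  · rintro ⟨w, z, n, rfl⟩
    cases w
    · refine ⟨![2 * n 0, 2 * n 1, 0], fun i => ?_⟩
      fin_cases i <;> simp [P112, WyckoffP112.site] <;> ring
    · refine ⟨![2 * n 0, 2 * n 1 + 1, 0], fun i => ?_⟩
      fin_cases i <;> simp [P112, WyckoffP112.site] <;> ring
    · refine ⟨![2 * n 0 + 1, 2 * n 1, 0], fun i => ?_⟩
      fin_cases i <;> simp [P112, WyckoffP112.site] <;> ring
    · refine ⟨![2 * n 0 + 1, 2 * n 1 + 1, 0], fun i => ?_⟩
      fin_cases i <;> simp [P112, WyckoffP112.site] <;> ring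

lemma WyckoffP112.exists_isSymmetricSite (w : WyckoffP112) (z : ℝ) :
    ∃ m, IsSymmetricSite P112 (w.site z) m :=
  isSymmetricSite_P112_iff.2 ⟨w, z, 0, by ext i; simp⟩

lemma isSymmetricSite_P11m_iff {q : Fin 3 → ℝ} : (∃ m, IsSymmetricSite P11m q m) ↔
    ∃ (w : WyckoffP11m) (x y : ℝ) (n : Fin 3 → ℤ), q = w.site x y + fun i => (n i : ℝ) := by
  constructor
  · rintro ⟨m, hm⟩
    have h2 : 2 * q 2 = m 2 := by rw [← hm 2]; simp [P11m]; ring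
    obtain ⟨n, hn | hn⟩ := exists_half_integer h2
    · refine ⟨.a, q 0, q 1, ![0, 0, n], ?_⟩
      ext i; fin_cases i <;> simp [WyckoffP11m.site, hn]
    · refine ⟨.b, q 0, q 1, ![0, 0, n], ?_⟩
      ext i; fin_cases i <;> simp [WyckoffP11m.site, hn]
  · rintro ⟨w, x, y, n, rfl⟩
    cases w
    · refine ⟨![0, 0, 2 * n 2], fun i => ?_⟩
      fin_cases i <;> simp [P11m, WyckoffP11m.site]
      ring
    · refine ⟨![0, 0, 2 * n 2 + 1], fun i => ?_⟩
      fin_cases i <;> simp [P11m, WyckoffP11m.site]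
      ring

lemma WyckoffP11m.exists_isSymmetricSite (w : WyckoffP11m) (x y : ℝ) :
    ∃ m, IsSymmetricSite P11m (w.site x y) m :=
  isSymmetricSite_P11m_iff.2 ⟨w, x, y, 0, by ext i; simp⟩

lemma exp_two_pi_half : Complex.exp (2 * Complex.I * Real.pi * ((1 / 2 : ℝ) : ℂ)) = -1 := by
  rw [← Complex.exp_pi_mul_I]
  congr 1
  push_cast
  ring

lemma P112_castSucc (j : Fin 2) : P112 j.castSucc = -1 := by fin_cases j <;> rfl

lemma WyckoffP112.exp_eq_wilson (w : WyckoffP112) (z : ℝ) (j : Fin 2) :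
    Complex.exp (2 * Complex.I * Real.pi * w.site z j.castSucc) = w.wilson j := by
  have h := exp_two_pi_half
  cases w <;> fin_cases j <;> simp [WyckoffP112.site, WyckoffP112.wilson] at h ⊢ <;> exact h

lemma WyckoffP11m.exp_eq_wilson (w : WyckoffP11m) (x y : ℝ) :
    Complex.exp (2 * Complex.I * Real.pi * w.site x y 2) = w.wilson := by
  have h := exp_two_pi_half
  cases w <;> simp [WyckoffP11m.site, WyckoffP11m.wilson] at h ⊢
  exact h

lemma WyckoffP112.wilson_injective : Function.Injective WyckoffP112.wilson := by
  have h : (-1 : ℂ) ≠ 1 := by norm_num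
  intro w w' e
  have e0 := congrFun e 0
  have e1 := congrFun e 1
  cases w <;> cases w' <;> simp [WyckoffP112.wilson, h, h.symm] at e0 e1 ⊢

lemma WyckoffP11m.wilson_injective : Function.Injective WyckoffP11m.wilson := by
  have h : (-1 : ℂ) ≠ 1 := by norm_num
  intro w w' e
  cases w <;> cases w' <;> simp [WyckoffP11m.wilson, h, h.symm] at e ⊢

end Wyckoff

theorem mainTheorem6 :
    -- space group `P112`
    ((∀ q : Fin 3 → ℝ, IsMaximalSite P112 q ↔
        ∃ (w : WyckoffP112) (z : ℝ) (n : Fin 3 → ℤ), q = w.site z + fun i => (n i : ℝ)) ∧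
      (∀ (w : WyckoffP112) (z : ℝ), HasUniqueKramersIrrep P112 (w.site z) ∧
        (∃ a : Shell P112, a.IsIrrepAt (w.site z)) ∧
        ∀ a : Shell P112, a.IsIrrepAt (w.site z) → (BandRep.induced a).IsElementary) ∧
      -- the four EBRs are irrep-equivalent but distinct
      (∀ (w w' : WyckoffP112) (z z' : ℝ) (a a' : Shell P112),
        a.IsIrrepAt (w.site z) → a'.IsIrrepAt (w'.site z') →
          (BandRep.induced a).IrrepEquivalent (BandRep.induced a') ∧
          (BandRep.induced a).LittleGroupEquivalent (BandRep.induced a') ∧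
          (w ≠ w' → ¬ (BandRep.induced a).GaugeEquivalent (BandRep.induced a'))) ∧
      -- two bands isolated from any further bands have Wilson loops `±1`
      (∀ (B : BandRep P112) (𝓗 : BlochHamiltonian B)
        (𝓑 : Finset (Fin (Fintype.card B.Index))) (j : Fin 2), 𝓑.card = 2 →
        (∀ t ∈ Icc 0 (2 * Real.pi), 𝓗.IsolatedAt 𝓑 (gLine j.castSucc t)) →
        ∀ ψ : ℝ → Matrix B.Index (Fin 2) ℂ, IsBlochFrame 𝓗 𝓑 j.castSucc ψ →
          WilsonLoopEq B j.castSucc ψ 1 ∨ WilsonLoopEq B j.castSucc ψ (-1)) ∧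
      -- the signs for bands that transform as the four EBRs, also if there are further bands
      (∀ (w : WyckoffP112) (z : ℝ) (a : Shell P112), a.IsIrrepAt (w.site z) →
        (∀ 𝓗 : BlochHamiltonian (BandRep.induced a),
          𝓗.TransformsAs Finset.univ (BandRep.induced a)) ∧
        ∀ (B : BandRep P112) (𝓗 : BlochHamiltonian B)
          (𝓑 : Finset (Fin (Fintype.card B.Index))) (j : Fin 2),
          𝓗.TransformsAs 𝓑 (BandRep.induced a) →
          (∃ ψ : ℝ → Matrix B.Index (Fin 2) ℂ, IsBlochFrame 𝓗 𝓑 j.castSucc ψ) ∧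
          ∀ ψ : ℝ → Matrix B.Index (Fin 2) ℂ, IsBlochFrame 𝓗 𝓑 j.castSucc ψ →
            WilsonLoopEq B j.castSucc ψ (w.wilson j • 1)) ∧
      Function.Injective WyckoffP112.wilson) ∧
    -- space group `P11m`
    ((∀ q : Fin 3 → ℝ, IsMaximalSite P11m q ↔
        ∃ (w : WyckoffP11m) (x y : ℝ) (n : Fin 3 → ℤ), q = w.site x y + fun i => (n i : ℝ)) ∧
      (∀ (w : WyckoffP11m) (x y : ℝ), HasUniqueKramersIrrep P11m (w.site x y) ∧
        (∃ a : Shell P11m, a.IsIrrepAt (w.site x y)) ∧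
        ∀ a : Shell P11m, a.IsIrrepAt (w.site x y) → (BandRep.induced a).IsElementary) ∧
      (∀ (w w' : WyckoffP11m) (x y x' y' : ℝ) (a a' : Shell P11m),
        a.IsIrrepAt (w.site x y) → a'.IsIrrepAt (w'.site x' y') →
          (BandRep.induced a).IrrepEquivalent (BandRep.induced a') ∧
          (BandRep.induced a).LittleGroupEquivalent (BandRep.induced a') ∧
          (w ≠ w' → ¬ (BandRep.induced a).GaugeEquivalent (BandRep.induced a'))) ∧
      (∀ (B : BandRep P11m) (𝓗 : BlochHamiltonian B)
        (𝓑 : Finset (Fin (Fintype.card B.Index))), 𝓑.card = 2 →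
        (∀ t ∈ Icc 0 (2 * Real.pi), 𝓗.IsolatedAt 𝓑 (gLine 2 t)) →
        ∀ ψ : ℝ → Matrix B.Index (Fin 2) ℂ, IsBlochFrame 𝓗 𝓑 2 ψ →
          WilsonLoopEq B 2 ψ 1 ∨ WilsonLoopEq B 2 ψ (-1)) ∧
      (∀ (w : WyckoffP11m) (x y : ℝ) (a : Shell P11m), a.IsIrrepAt (w.site x y) →
        (∀ 𝓗 : BlochHamiltonian (BandRep.induced a),
          𝓗.TransformsAs Finset.univ (BandRep.induced a)) ∧
        ∀ (B : BandRep P11m) (𝓗 : BlochHamiltonian B)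
          (𝓑 : Finset (Fin (Fintype.card B.Index))),
          𝓗.TransformsAs 𝓑 (BandRep.induced a) →
          (∃ ψ : ℝ → Matrix B.Index (Fin 2) ℂ, IsBlochFrame 𝓗 𝓑 2 ψ) ∧
          ∀ ψ : ℝ → Matrix B.Index (Fin 2) ℂ, IsBlochFrame 𝓗 𝓑 2 ψ →
            WilsonLoopEq B 2 ψ (w.wilson • 1)) ∧
      Function.Injective WyckoffP11m.wilson) := by

  refine ⟨⟨fun q => isMaximalSite_iff.trans isSymmetricSite_P112_iff, fun w z => ?_,
    fun w w' z z' a a' ha ha' => ?_, fun B 𝓗 𝓑 j _ _ ψ hψ =>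
      hψ.wilsonLoopEq_one_or_neg_one (P112_castSucc j), fun w z a ha =>
      ⟨fun 𝓗 => 𝓗.transformsAs_univ, fun B 𝓗 𝓑 j hT => ?_⟩, WyckoffP112.wilson_injective⟩,
    ⟨fun q => isMaximalSite_iff.trans isSymmetricSite_P11m_iff, fun w x y => ?_,
    fun w w' x y x' y' a a' ha ha' => ?_, fun B 𝓗 𝓑 _ _ ψ hψ =>
      hψ.wilsonLoopEq_one_or_neg_one rfl, fun w x y a ha =>
      ⟨fun 𝓗 => 𝓗.transformsAs_univ, fun B 𝓗 𝓑 hT => ?_⟩, WyckoffP11m.wilson_injective⟩⟩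
  · obtain ⟨m, hm⟩ := w.exists_isSymmetricSite z
    exact ⟨hasUniqueKramersIrrep hm, exists_shell_isIrrepAt hm, fun a ha => ha.isElementary hm⟩
  · obtain ⟨m, hm⟩ := w.exists_isSymmetricSite z
    obtain ⟨m', hm'⟩ := w'.exists_isSymmetricSite z'
    refine ⟨ha.irrepEquivalent hm ha' hm', ha.littleGroupEquivalent hm ha' hm', fun hw hg => hw ?_⟩
    refine WyckoffP112.wilson_injective (funext fun j => ?_)
    rw [← w.exp_eq_wilson z, ← w'.exp_eq_wilson z']
    exact ha.exp_eq_of_gaugeEquivalent hm ha' hm' (P112_castSucc j) hg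
  · obtain ⟨m, hm⟩ := w.exists_isSymmetricSite z
    rw [← w.exp_eq_wilson z]
    exact ha.wilsonLoopEq_exp hm (P112_castSucc j) hT
  · obtain ⟨m, hm⟩ := w.exists_isSymmetricSite x y
    exact ⟨hasUniqueKramersIrrep hm, exists_shell_isIrrepAt hm, fun a ha => ha.isElementary hm⟩
  · obtain ⟨m, hm⟩ := w.exists_isSymmetricSite x y
    obtain ⟨m', hm'⟩ := w'.exists_isSymmetricSite x' y'
    refine ⟨ha.irrepEquivalent hm ha' hm', ha.littleGroupEquivalent hm ha' hm', fun hw hg => hw ?_⟩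
    refine WyckoffP11m.wilson_injective ?_
    rw [← w.exp_eq_wilson x y, ← w'.exp_eq_wilson x' y']
    exact ha.exp_eq_of_gaugeEquivalent hm ha' hm' rfl hg
  · obtain ⟨m, hm⟩ := w.exists_isSymmetricSite x y
    rw [← w.exp_eq_wilson x y]
    exact ha.wilsonLoopEq_exp hm rfl hT
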